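/- Let $n \in \mathbb{N}$, let $\mathcal{E}$ be a complex Hilbert space, and let $H^2_{\mathcal{E}}(\mathbb{D}^n)$ be the Hardy space of all power series $\sum_{k \in \mathbb{N}^n} a_k z^k$ on the polydisc $\mathbb{D}^n$ with $a_k \in \mathcal{E}$ and $\sum_k \|a_k\|^2 < \infty$, identified through boundary values with a closed subspace of $L^2_{\mathcal{E}}(\mathbb{T}^n)$. Let $\Phi \in L^\infty_{\mathcal{B}(\mathcal{E})}(\mathbb{T}^n)$ (an essentially bounded, strongly measurable function $\mathbb{T}^n \to \mathcal{B}(\mathcal{E})$), and let $T_\Phi f = P(\Phi f)$ be the Toeplitz operator on $H^2_{\mathcal{E}}(\mathbb{D}^n)$ with symbol $\Phi$, where $P$ is the orthogonal projection of $L^2_{\mathcal{E}}(\mathbb{T}^n)$ onto $H^2_{\mathcal{E}}(\mathbb{D}^n)$. Assume that $T_\Phi$ is a partial isometry, that is, $T_\Phi$ is isometric on $(\ker T_\Phi)^\perp$. Then the following are equivalent. (i) $T_\Phi$ is normal, that is, $T_\Phi^* T_\Phi = T_\Phi T_\Phi^*$. (ii) There exist a Hilbert space $\mathcal{F}$, an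 inner function $\Psi \in H^\infty_{\mathcal{B}(\mathcal{F},\mathcal{E})}(\mathbb{D}^n)$ and a unitary $U \in \mathcal{B}(\mathcal{F})$ such that $$T_\Phi = M_\Psi U M_\Psi^*.$$ Here $M_\Psi : H^2_{\mathcal{F}}(\mathbb{D}^n) \to H^2_{\mathcal{E}}(\mathbb{D}^n)$, $(M_\Psi f)(z) = \Psi(z) f(z)$, is the multiplication operator, and $U$ acts on $H^2_{\mathcal{F}}(\mathbb{D}^n)$ as the constant operator $I \otimes U$, $\sum_k a_k z^k \mapsto \sum_k (U a_k) z^k$. A bounded analytic function $\Psi : \mathbb{D}^n \to \mathcal{B}(\mathcal{F},\mathcal{E})$ is called inner if its radial boundary values are isometries almost everywhere on $\mathbb{T}^n$: for each $\eta \in \mathcal{F}$, for almost every $\zeta \in \mathbb{T}^n$, the limit $\Psi(\zeta)\eta = \lim_{r \to 1^-} \Psi(r\zeta)\eta$ exists and $\|\Psi(\zeta)\eta\| = \|\eta\|$. (If $\mathcal{F}$ is separable, the exceptional null set can be chosen independently of $\eta$, so that $\Psi(\zeta)$ is an isometry for almost every $\zeta$.) -/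

import Mathlib

universe u

open MeasureTheory Filter Topology
open scoped ENNReal

namespace PolydiscToeplitz

noncomputable section

/-! ### The torus and the polydisc -/

/-- The normalized Lebesgue measure on the `n`-torus. The torus is parametrized by
`UnitAddTorus (Fin n) = (ℝ/ℤ)ⁿ`. -/
def torusMeasure (n : ℕ) : Measure (UnitAddTorus (Fin n)) :=
  Measure.pi fun _ => (AddCircle.haarAddCircle : Measure UnitAddCircle)

instance (n : ℕ) : IsProbabilityMeasure (torusMeasure n) := by
  unfold torusMeasure; infer_instance

/-- The point `(exp (2πi t₁), …, exp (2πi tₙ))` of `𝕋ⁿ ⊆ ℂⁿ` with parameter `t`. -/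
def torusPoint {n : ℕ} (t : UnitAddTorus (Fin n)) : Fin n → ℂ :=
  fun i => (AddCircle.toCircle (t i) : ℂ)

theorem norm_torusPoint {n : ℕ} (t : UnitAddTorus (Fin n)) (i : Fin n) : ‖torusPoint t i‖ = 1 :=
  Circle.norm_coe _

/-- The open unit polydisc `𝔻ⁿ ⊆ ℂⁿ`. -/
def polydisc (n : ℕ) : Set (Fin n → ℂ) := {z | ∀ i, ‖z i‖ < 1}

/-- The monomial `ζ ^ k = ζ₁ ^ k₁ ⋯ ζₙ ^ kₙ`, `k ∈ ℕⁿ`, on the torus. -/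
def torusMonomial {n : ℕ} (k : Fin n → ℕ) : C(UnitAddTorus (Fin n), ℂ) :=
  UnitAddTorus.mFourier fun i => (k i : ℤ)

theorem torusMonomial_apply {n : ℕ} (k : Fin n → ℕ) (t : UnitAddTorus (Fin n)) :
    torusMonomial k t = ∏ i, torusPoint t i ^ k i := by
  simp [torusMonomial, UnitAddTorus.mFourier, torusPoint, fourier_apply, AddCircle.toCircle_nsmul]

theorem norm_torusMonomial_apply {n : ℕ} (k : Fin n → ℕ) (t : UnitAddTorus (Fin n)) :
    ‖torusMonomial k t‖ = 1 := by
  simp [torusMonomial_apply, norm_torusPoint]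

/-! ### Vector-valued `L²` and Hardy spaces -/

variable {E : Type*} [NormedAddCommGroup E] [InnerProductSpace ℂ E]

/-- The space `L²(𝕋ⁿ, E)`. -/
abbrev TorusL2 (n : ℕ) (E : Type*) [NormedAddCommGroup E] : Type _ := Lp E 2 (torusMeasure n)

/-- The Hardy space `H²_E(𝔻ⁿ)`: the power series `∑ k, z ^ k a_k` on `𝔻ⁿ` with coefficients
`a_k ∈ E`, `k ∈ ℕⁿ`, such that `∑ k, ‖a_k‖ ^ 2 < ∞`. An element is given by its
coefficients; the analytic function that it stands for is `HardySpace.eval`. -/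
abbrev HardySpace (n : ℕ) (E : Type*) [NormedAddCommGroup E] : Type _ :=
  lp (fun _ : Fin n → ℕ => E) 2

/-- The value `f(z) = ∑ k, z ^ k a_k` of an element of the Hardy space at `z ∈ 𝔻ⁿ`. -/
def HardySpace.eval {n : ℕ} (f : HardySpace n E) (z : Fin n → ℂ) : E :=
  ∑' k : Fin n → ℕ, (∏ i, z i ^ k i) • f k

theorem summable_monomial {n : ℕ} {z : Fin n → ℂ} (hz : z ∈ polydisc n) :
    Summable fun k : Fin n → ℕ => ‖∏ i, z i ^ k i‖ := by
  induction n with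
  | zero => exact Summable.of_finite
  | succ n ih =>
    refine ((Fin.consEquiv fun _ : Fin (n + 1) => ℕ).summable_iff).1 ?_
    have h0 : Summable fun m : ℕ => ‖z 0 ^ m‖ := by
      simpa using summable_geometric_of_lt_one (norm_nonneg _) (hz 0)
    have h1 := ih (z := fun i => z i.succ) fun i => hz i.succ
    refine (h0.mul_of_nonneg h1 (fun _ => norm_nonneg _) fun _ => norm_nonneg _).congr ?_
    rintro ⟨m, k⟩
    simp [Fin.consEquiv, Fin.prod_univ_succ]

/-- The series that defines `HardySpace.eval` converges on the polydisc. -/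
theorem HardySpace.hasSum_eval [CompleteSpace E] {n : ℕ} (f : HardySpace n E) {z : Fin n → ℂ}
    (hz : z ∈ polydisc n) :
    HasSum (fun k : Fin n → ℕ => (∏ i, z i ^ k i) • f k) (f.eval z) := by
  refine Summable.hasSum (.of_norm ?_)
  refine ((summable_monomial hz).mul_right ‖f‖).of_nonneg_of_le (fun _ => norm_nonneg _) ?_
  intro k
  rw [norm_smul]
  gcongr
  exact lp.norm_apply_le_norm (by norm_num) f k

theorem memLp_monomial_smul {n : ℕ} (k : Fin n → ℕ) (η : E) :
    MemLp (fun t => torusMonomial k t • η) 2 (torusMeasure n) :=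
  MemLp.of_bound (by fun_prop) ‖η‖ (.of_forall fun t => by
    simp [norm_torusMonomial_apply, norm_smul])

/-- The isometric embedding `η ↦ ζ ^ k η` of `E` into `L²(𝕋ⁿ, E)`. -/
def monomialEmbedding {n : ℕ} (k : Fin n → ℕ) : E →ₗᵢ[ℂ] TorusL2 n E where
  toFun η := (memLp_monomial_smul k η).toLp _
  map_add' η ξ := by
    rw [← MemLp.toLp_add]
    exact MemLp.toLp_congr _ _ (.of_forall fun t => by simp)
  map_smul' c η := by
    rw [RingHom.id_apply, ← MemLp.toLp_const_smul]
    exact MemLp.toLp_congr _ _ (.of_forall fun t => by simp [smul_comm c])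
  norm_map' η := by
    change ‖(memLp_monomial_smul k η).toLp _‖ = ‖η‖
    rw [Lp.norm_toLp, eLpNorm_congr_norm_ae (g := fun _ => η)
      (.of_forall fun t => by simp [norm_torusMonomial_apply, norm_smul])]
    rw [eLpNorm_const _ (by norm_num) (IsProbabilityMeasure.ne_zero _)]
    simp

theorem orthogonalFamily_monomialEmbedding (n : ℕ) (E : Type*) [NormedAddCommGroup E]
    [InnerProductSpace ℂ E] :
    OrthogonalFamily ℂ (fun _ : Fin n → ℕ => E) (monomialEmbedding (n := n) (E := E)) := by
  intro k l hkl η ξ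
  have hne : (fun i => (k i : ℤ)) ≠ fun i => (l i : ℤ) := fun h => hkl <| by
    funext i; exact_mod_cast congrFun h i
  have h0 := (UnitAddTorus.orthonormal_mFourier (d := Fin n)).2 hne
  simp only [ContinuousMap.inner_toLp] at h0
  rw [L2.inner_def]
  have : ∀ᵐ t ∂torusMeasure n,
      inner ℂ (monomialEmbedding k η t) (monomialEmbedding l ξ t) =
        (torusMonomial l t * (starRingEnd ℂ) (torusMonomial k t)) * inner ℂ η ξ := by
    filter_upwards [(memLp_monomial_smul k η).coeFn_toLp, (memLp_monomial_smul l ξ).coeFn_toLp]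
      with t h1 h2
    change inner ℂ ((memLp_monomial_smul k η).toLp _ t) ((memLp_monomial_smul l ξ).toLp _ t) = _
    rw [h1, h2, inner_smul_left, inner_smul_right]
    ring
  rw [integral_congr_ae this, integral_mul_const]
  refine mul_eq_zero_of_left ?_ _
  exact h0

/-- The boundary map `∑ k, z ^ k a_k ↦ ∑ k, ζ ^ k a_k`, which identifies `H²_E(𝔻ⁿ)` isometrically
with the Hardy space `H²_E(𝕋ⁿ)`, a closed subspace of `L²(𝕋ⁿ, E)`. -/
def boundary (n : ℕ) (E : Type*) [NormedAddCommGroup E] [InnerProductSpace ℂ E]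
    [CompleteSpace E] : HardySpace n E →ₗᵢ[ℂ] TorusL2 n E :=
  (orthogonalFamily_monomialEmbedding n E).linearIsometry

/-! ### Laurent and Toeplitz operators -/

/-- Operator-valued symbols, the elements of `L^∞_{B(E)}(𝕋ⁿ)`: essentially bounded functions
`Φ : 𝕋ⁿ → B(E)` that are measurable in the strong operator topology, that is, `t ↦ Φ(t) η` is
measurable for each `η ∈ E`. -/
structure LInfty (n : ℕ) (E : Type*) [NormedAddCommGroup E] [InnerProductSpace ℂ E] where
  toFun : UnitAddTorus (Fin n) → E →L[ℂ] E
  aestronglyMeasurable_apply : ∀ η : E,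
    AEStronglyMeasurable (fun t => toFun t η) (torusMeasure n)
  essBounded : ∃ C : ℝ, ∀ᵐ t ∂torusMeasure n, ‖toFun t‖ ≤ C

namespace LInfty

variable {n : ℕ}

theorem aestronglyMeasurable_simpleFunc (Φ : LInfty n E)
    (g : SimpleFunc (UnitAddTorus (Fin n)) E) :
    AEStronglyMeasurable (fun t => Φ.toFun t (g t)) (torusMeasure n) := by
  classical
  induction g using SimpleFunc.induction with
  | const c hs =>
    rename_i s
    refine ((Φ.aestronglyMeasurable_apply c).indicator hs).congr (.of_forall fun t => ?_)
    by_cases ht : t ∈ s <;> simp [Set.indicator, Set.piecewise, ht]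
  | add _ hf hg =>
    refine (hf.add hg).congr (.of_forall fun t => ?_)
    simp

theorem aestronglyMeasurable_mul (Φ : LInfty n E) {f : UnitAddTorus (Fin n) → E}
    (hf : AEStronglyMeasurable f (torusMeasure n)) :
    AEStronglyMeasurable (fun t => Φ.toFun t (f t)) (torusMeasure n) := by
  obtain ⟨g, hg, hfg⟩ := hf
  have hmeas : AEStronglyMeasurable (fun t => Φ.toFun t (g t)) (torusMeasure n) :=
    aestronglyMeasurable_of_tendsto_ae atTop
      (fun k => Φ.aestronglyMeasurable_simpleFunc (hg.approx k))
      (.of_forall fun t => ((Φ.toFun t).continuous.tendsto _).comp (hg.tendsto_approx t))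
  refine hmeas.congr ?_
  filter_upwards [hfg] with t ht
  rw [ht]

/-- An essential bound of the symbol. -/
def bound (Φ : LInfty n E) : ℝ := Φ.essBounded.choose

theorem ae_norm_mul_le (Φ : LInfty n E) (f : UnitAddTorus (Fin n) → E) :
    ∀ᵐ t ∂torusMeasure n, ‖Φ.toFun t (f t)‖ ≤ Φ.bound * ‖f t‖ := by
  filter_upwards [Φ.essBounded.choose_spec] with t ht
  exact (Φ.toFun t).le_of_opNorm_le ht _

theorem memLp_mul (Φ : LInfty n E) (f : TorusL2 n E) :
    MemLp (fun t => Φ.toFun t (f t)) 2 (torusMeasure n) :=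
  (Lp.memLp f).of_le_mul (Φ.aestronglyMeasurable_mul (Lp.aestronglyMeasurable f))
    (Φ.ae_norm_mul_le f)

/-- The Laurent operator `L_Φ` on `L²(𝕋ⁿ, E)`: `(L_Φ f)(ζ) = Φ(ζ) f(ζ)`. -/
def laurent (Φ : LInfty n E) : TorusL2 n E →L[ℂ] TorusL2 n E :=
  LinearMap.mkContinuous
    { toFun := fun f => (Φ.memLp_mul f).toLp _
      map_add' := fun f g => by
        rw [← MemLp.toLp_add]
        refine MemLp.toLp_congr _ _ ?_
        filter_upwards [Lp.coeFn_add f g] with t ht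
        rw [ht, Pi.add_apply, map_add]
        rfl
      map_smul' := fun c f => by
        rw [RingHom.id_apply, ← MemLp.toLp_const_smul]
        refine MemLp.toLp_congr _ _ ?_
        filter_upwards [Lp.coeFn_smul c f] with t ht
        rw [ht, Pi.smul_apply, map_smul]
        rfl }
    Φ.bound
    fun f => by
      refine Lp.norm_le_mul_norm_of_ae_le_mul ?_
      filter_upwards [(Φ.memLp_mul f).coeFn_toLp, Φ.ae_norm_mul_le f] with t h1 h2
      simpa [h1] using h2

theorem laurent_coeFn (Φ : LInfty n E) (f : TorusL2 n E) :
    Φ.laurent f =ᵐ[torusMeasure n] fun t => Φ.toFun t (f t) :=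
  (Φ.memLp_mul f).coeFn_toLp

/-- The Toeplitz operator `T_Φ = P L_Φ|` on `H²_E(𝔻ⁿ)`, where `P` is the orthogonal projection of
`L²(𝕋ⁿ, E)` onto the Hardy space. With `J` the isometric embedding `boundary` of `H²_E(𝔻ⁿ)`,
whose adjoint is `J⁻¹ P`, this is `J* L_Φ J`. -/
def toeplitz [CompleteSpace E] (Φ : LInfty n E) : HardySpace n E →L[ℂ] HardySpace n E :=
  ContinuousLinearMap.adjoint (boundary n E).toContinuousLinearMap ∘L Φ.laurent ∘L (boundary n E).toContinuousLinearMap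

end LInfty

/-! ### Partial isometries -/

/-- A bounded operator is a partial isometry if it is isometric on the orthogonal complement of its
kernel. -/
def IsPartialIsometry {H : Type*} [NormedAddCommGroup H] [InnerProductSpace ℂ H]
    (T : H →L[ℂ] H) : Prop :=
  ∀ x ∈ (LinearMap.ker (T : H →ₗ[ℂ] H))ᗮ, ‖T x‖ = ‖x‖

/-! ### Bounded analytic functions, inner functions, multiplication operators -/

variable {F : Type*} [NormedAddCommGroup F] [InnerProductSpace ℂ F]

/-- `Ψ ∈ H^∞_{B(F,E)}(𝔻ⁿ)`: the function `Ψ` is analytic and bounded on the polydisc (its values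
outside of the polydisc are irrelevant). -/
def IsHInfty {n : ℕ} (Ψ : (Fin n → ℂ) → F →L[ℂ] E) : Prop :=
  DifferentiableOn ℂ Ψ (polydisc n) ∧ ∃ C : ℝ, ∀ z ∈ polydisc n, ‖Ψ z‖ ≤ C

/-- `Ψ` has, almost everywhere on `𝕋ⁿ`, isometric boundary values: for each `η ∈ F` and almost
every `ζ ∈ 𝕋ⁿ` the radial limit `Ψ(ζ) η = lim_{r → 1-} Ψ(r ζ) η` exists and has the norm of `η`.
For separable `F` the exceptional null set can be chosen independently of `η`; see
`hasIsometricBoundaryValues_iff`. -/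
def HasIsometricBoundaryValues {n : ℕ} (Ψ : (Fin n → ℂ) → F →L[ℂ] E) : Prop :=
  ∀ η : F, ∀ᵐ t ∂torusMeasure n, ∃ y : E,
    Tendsto (fun r : ℝ => Ψ (r • torusPoint t) η) (𝓝[<] 1) (𝓝 y) ∧ ‖y‖ = ‖η‖

/-- An inner function `Ψ ∈ H^∞_{B(F,E)}(𝔻ⁿ)`: the boundary values are isometries almost everywhere
on `𝕋ⁿ`. -/
def IsInner {n : ℕ} (Ψ : (Fin n → ℂ) → F →L[ℂ] E) : Prop :=
  IsHInfty Ψ ∧ HasIsometricBoundaryValues Ψ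

theorem smul_torusPoint_mem {n : ℕ} (t : UnitAddTorus (Fin n)) {r : ℝ} (h0 : 0 < r) (h1 : r < 1) :
    r • torusPoint t ∈ polydisc n := by
  intro i
  rw [Pi.smul_apply, norm_smul, norm_torusPoint, mul_one, Real.norm_of_nonneg h0.le]
  exact h1

/-- For separable `F`, a bounded analytic function has isometric boundary values if and only if,
for almost every `ζ ∈ 𝕋ⁿ`, the operators `Ψ(r ζ)` converge strongly to an isometry as `r → 1-`. -/
theorem hasIsometricBoundaryValues_iff [CompleteSpace E] [TopologicalSpace.SeparableSpace F]
    {n : ℕ} {Ψ : (Fin n → ℂ) → F →L[ℂ] E} (hΨ : IsHInfty Ψ) :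
    HasIsometricBoundaryValues Ψ ↔ ∀ᵐ t ∂torusMeasure n, ∃ V : F →ₗᵢ[ℂ] E, ∀ η : F,
      Tendsto (fun r : ℝ => Ψ (r • torusPoint t) η) (𝓝[<] 1) (𝓝 (V η)) := by
  constructor
  · intro h
    obtain ⟨C, hC⟩ := hΨ.2
    have hd : ∀ᵐ t ∂torusMeasure n, ∀ m : ℕ, ∃ y : E,
        Tendsto (fun r : ℝ => Ψ (r • torusPoint t) (TopologicalSpace.denseSeq F m)) (𝓝[<] 1) (𝓝 y)
          ∧ ‖y‖ = ‖TopologicalSpace.denseSeq F m‖ := ae_all_iff.2 fun m => h _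
    filter_upwards [hd] with t ht
    have hr : ∀ᶠ r : ℝ in 𝓝[<] 1, ‖Ψ (r • torusPoint t)‖ ≤ max C 1 := by
      filter_upwards [Ioo_mem_nhdsLT (zero_lt_one' ℝ)] with r hr
      exact (hC _ (smul_torusPoint_mem t hr.1 hr.2)).trans (le_max_left _ _)
    have hB : 0 < max C 1 := lt_max_of_lt_right one_pos
    have key : ∀ η : F, ∃ y : E,
        Tendsto (fun r : ℝ => Ψ (r • torusPoint t) η) (𝓝[<] 1) (𝓝 y) ∧ ‖y‖ = ‖η‖ := by
      intro η
      have hap : ∀ ε > 0, ∃ m, dist η (TopologicalSpace.denseSeq F m) < ε := fun ε hε =>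
        (TopologicalSpace.denseRange_denseSeq F).exists_dist_lt η hε
      have hlim : ∃ y : E, Tendsto (fun r : ℝ => Ψ (r • torusPoint t) η) (𝓝[<] 1) (𝓝 y) := by
        refine cauchy_map_iff_exists_tendsto.1 ?_
        rw [Metric.cauchy_iff]
        refine ⟨inferInstance, fun ε hε => ?_⟩
        obtain ⟨m, hm⟩ := hap (ε / (4 * max C 1)) (by positivity)
        obtain ⟨y, hy, -⟩ := ht m
        have hy' := hy (Metric.ball_mem_nhds y (show 0 < ε / 4 by positivity))
        refine ⟨_, image_mem_map (inter_mem hr hy'), ?_⟩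
        rintro _ ⟨r, ⟨h1, h2⟩, rfl⟩ _ ⟨s, ⟨h3, h4⟩, rfl⟩
        have hmul : ‖η - TopologicalSpace.denseSeq F m‖ * max C 1 < ε / 4 := by
          rw [dist_eq_norm, lt_div_iff₀ (by positivity)] at hm
          linarith
        have e : ∀ r : ℝ, ‖Ψ (r • torusPoint t)‖ ≤ max C 1 →
            dist (Ψ (r • torusPoint t) η)
              (Ψ (r • torusPoint t) (TopologicalSpace.denseSeq F m)) < ε / 4 := by
          intro r h
          rw [dist_eq_norm, ← map_sub]
          calc _ ≤ max C 1 * ‖η - TopologicalSpace.denseSeq F m‖ :=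
                ContinuousLinearMap.le_of_opNorm_le _ h _
            _ < ε / 4 := by linarith
        have e1 := e r h1
        have e2 := e s h3
        have e3 : dist (Ψ (r • torusPoint t) (TopologicalSpace.denseSeq F m)) y < ε / 4 := h2
        have e4 : dist (Ψ (s • torusPoint t) (TopologicalSpace.denseSeq F m)) y < ε / 4 := h4
        have t1 := dist_triangle4 (Ψ (r • torusPoint t) η)
          (Ψ (r • torusPoint t) (TopologicalSpace.denseSeq F m))
          (Ψ (s • torusPoint t) (TopologicalSpace.denseSeq F m)) (Ψ (s • torusPoint t) η)
        have t2 := dist_triangle_right (Ψ (r • torusPoint t) (TopologicalSpace.denseSeq F m))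
          (Ψ (s • torusPoint t) (TopologicalSpace.denseSeq F m)) y
        rw [dist_comm (Ψ (s • torusPoint t) (TopologicalSpace.denseSeq F m))
          (Ψ (s • torusPoint t) η)] at t1
        linarith
      obtain ⟨y, hy⟩ := hlim
      refine ⟨y, hy, ?_⟩
      by_contra hne
      have hpos : 0 < |‖y‖ - ‖η‖| := abs_pos.2 (sub_ne_zero.2 hne)
      obtain ⟨m, hm⟩ := hap (|‖y‖ - ‖η‖| / (2 * max C 1)) (by positivity)
      obtain ⟨y', hy', hn⟩ := ht m
      rw [dist_eq_norm, lt_div_iff₀ (by positivity)] at hm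
      have hle : ‖y - y'‖ ≤ max C 1 * ‖η - TopologicalSpace.denseSeq F m‖ := by
        refine le_of_tendsto (hy.sub hy').norm ?_
        filter_upwards [hr] with r h
        rw [← map_sub]
        exact ContinuousLinearMap.le_of_opNorm_le _ h _
      have a1 := abs_norm_sub_norm_le y y'
      have a2 := abs_norm_sub_norm_le η (TopologicalSpace.denseSeq F m)
      have a3 : ‖η - TopologicalSpace.denseSeq F m‖ ≤
          max C 1 * ‖η - TopologicalSpace.denseSeq F m‖ :=
        le_mul_of_one_le_left (norm_nonneg _) (le_max_right _ _)
      have a4 : |‖y‖ - ‖η‖| ≤ |‖y‖ - ‖y'‖| + |‖η‖ - ‖TopologicalSpace.denseSeq F m‖| := by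
        rw [hn, abs_sub_comm ‖η‖]
        exact abs_sub_le _ _ _
      linarith
    choose V hV hn using key
    refine ⟨⟨⟨⟨V, fun η ξ => ?_⟩, fun c η => ?_⟩, hn⟩, hV⟩
    · exact tendsto_nhds_unique (hV _) (by simpa using (hV η).add (hV ξ))
    · exact tendsto_nhds_unique (hV _) (by simpa using (hV η).const_smul c)
  · intro h η
    filter_upwards [h] with t ⟨V, hV⟩
    exact ⟨V η, hV η, V.norm_map η⟩

/-- `M` is the multiplication operator `M_Ψ : H²_F(𝔻ⁿ) → H²_E(𝔻ⁿ)`: `(M f)(z) = Ψ(z) f(z)` for all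
`f ∈ H²_F(𝔻ⁿ)` and `z ∈ 𝔻ⁿ`. Since an element of `H²_E(𝔻ⁿ)` is determined by its values on `𝔻ⁿ`,
this equation determines `M`. -/
def IsMultiplicationOperator {n : ℕ} (Ψ : (Fin n → ℂ) → F →L[ℂ] E)
    (M : HardySpace n F →L[ℂ] HardySpace n E) : Prop :=
  ∀ (f : HardySpace n F), ∀ z ∈ polydisc n, (M f).eval z = Ψ z (f.eval z)

/-- The operator `I ⊗ U` on `H²_F(𝔻ⁿ)` of a constant `U ∈ B(F)`, which maps `∑ k, z ^ k a_k` to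
`∑ k, z ^ k (U a_k)`. -/
def constantOperator (n : ℕ) (U : F →L[ℂ] F) : HardySpace n F →L[ℂ] HardySpace n F :=
  lp.mapCLM 2 (fun _ => U) (norm_nonneg U) fun _ => le_rfl

end

end PolydiscToeplitz

namespace PolydiscToeplitz

noncomputable section

section

variable {n : ℕ} {E : Type*} [NormedAddCommGroup E] [InnerProductSpace ℂ E]

/-! ### Shifts on the Hardy space -/

/-! Write `S_i` for multiplication by `z_i`, `T` for the Toeplitz operator and `K` for its initial
space `(ker T)ᗮ`. The only property of Toeplitz operators that the forward direction uses is `S_i* T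
S_i = T` (`adjoint_shift_toeplitz_shift`).

For `f ∈ K` this gives `‖f‖ = ‖T f‖ = ‖S_i* T S_i f‖ ≤ ‖T S_i f‖ ≤ ‖S_i f‖ = ‖f‖`. Equality
throughout forces `S_i f ∈ K` and `T S_i f = S_i T f` (`IsPartialIsometry.mem_and_comm`). So `K` is
shift invariant and `T` commutes with the shifts on it. The decisive point is that the restricted
shifts on `K` again commute doubly (`IsPartialIsometry.isDoublyCommuting_restrict`), which fails for
general invariant subspaces. The Wold decomposition (`IsDoublyCommuting.isHilbertSum`) then gives `K
= ⨁ z ^ k W` with `W` the joint kernel of the adjoints of the restricted shifts. Hence `K` is the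
range of an isometry `V` of `H²_W` that intertwines the shifts. By normality `T` maps `K` unitarily
onto itself; it commutes with the shifts there, so it restricts to a unitary `U` of `W`, and `T = V
U V*` (`IsPartialIsometry.exists_model`).

An isometry that intertwines the shifts is multiplication by an inner function `Ψ(z) η = (V η)(z)`
(`isInner_symbol`). Testing on Szegő kernels shows `‖Ψ(z)‖ ≤ 1`. The boundary function of `V η` then
has norm at most `‖η‖` pointwise and exactly `‖η‖` in `L²` of a probability measure, hence `‖η‖`
almost everywhere. That radial limits exist and equal the boundary function is Fatou's theorem on
the polydisc (`ae_tendsto_eval_boundary`), reduced to Fatou's theorem on the circle along the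
diagonal circles `s ↦ (s ζ₁, …, s ζₙ)`.

Conversely, isometric boundary values make `M` an isometry, so `M* M = 1`, and the normality of `M U
M*` follows from that of `U`. -/

/-- The embedding `η ↦ z ^ k η` of `E` into the Hardy space. -/
def monomial (k : Fin n → ℕ) : E →ₗᵢ[ℂ] HardySpace n E where
  toFun η := lp.single 2 k η
  map_add' η ξ := lp.single_add (E := fun _ : Fin n → ℕ => E) 2 k η ξ
  map_smul' c η := lp.single_smul (E := fun _ : Fin n → ℕ => E) 2 k c η
  norm_map' η := lp.norm_single (E := fun _ : Fin n → ℕ => E) (p := 2) two_pos k η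

theorem monomial_eq (k : Fin n → ℕ) (η : E) :
    (monomial k η : HardySpace n E) = lp.single 2 k η := rfl

theorem inner_monomial_left (k : Fin n → ℕ) (η : E) (f : HardySpace n E) :
    inner ℂ (monomial k η) f = inner ℂ η (f k) :=
  lp.inner_single_left k η f

theorem inner_monomial_monomial_of_ne {k l : Fin n → ℕ} (h : k ≠ l) (η ξ : E) :
    inner ℂ (monomial k η : HardySpace n E) (monomial l ξ) = 0 := by
  rw [inner_monomial_left, monomial_eq, lp.single_apply_ne _ _ _ h, inner_zero_right]

theorem hasSum_monomial (f : HardySpace n E) : HasSum (fun k => monomial k (f k)) f :=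
  lp.hasSum_single (by norm_num) f

theorem hardySpace_ext {G : Type*} [AddCommMonoid G] [Module ℂ G] [TopologicalSpace G]
    [T2Space G] {A B : HardySpace n E →L[ℂ] G} (h : ∀ k η, A (monomial k η) = B (monomial k η)) :
    A = B := by
  ext f
  have hf := hasSum_monomial f
  have hA := hf.map A A.continuous
  have hB := hf.map B B.continuous
  refine hA.unique ?_
  convert hB using 1
  funext k
  exact h k (f k)

theorem eq_zero_of_forall_inner_monomial {f : HardySpace n E}
    (h : ∀ k η, inner ℂ (monomial k η) f = 0) : f = 0 := by
  ext k
  have := h k (f k)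
  rw [inner_monomial_left] at this
  simpa using this

theorem orthogonalFamily_monomial_add (l : Fin n → ℕ) :
    OrthogonalFamily ℂ (fun _ : Fin n → ℕ => E)
      fun k => (monomial (k + l) : E →ₗᵢ[ℂ] HardySpace n E) := by
  intro k k' hk η ξ
  exact inner_monomial_monomial_of_ne (fun h => hk (add_right_cancel h)) η ξ

theorem eval_monomial (k : Fin n → ℕ) (η : E) (z : Fin n → ℂ) :
    (monomial k η : HardySpace n E).eval z = (∏ i, z i ^ k i) • η := by
  refine (tsum_eq_single k fun l hl => ?_).trans ?_
  · rw [monomial_eq, lp.single_apply_ne _ _ _ hl, smul_zero]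
  · rw [monomial_eq, lp.single_apply_self]

variable [CompleteSpace E]

/-- The shift `f ↦ z ^ l f` on the Hardy space. -/
def shift (l : Fin n → ℕ) : HardySpace n E →ₗᵢ[ℂ] HardySpace n E :=
  (orthogonalFamily_monomial_add l).linearIsometry

theorem shift_monomial (l k : Fin n → ℕ) (η : E) :
    shift l (monomial k η) = monomial (k + l) η :=
  (orthogonalFamily_monomial_add l).linearIsometry_apply_single η

theorem shift_zero (f : HardySpace n E) : shift 0 f = f := by
  have : (shift 0 : HardySpace n E →ₗᵢ[ℂ] _).toContinuousLinearMap = .id ℂ _ :=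
    hardySpace_ext fun k η => by simp [shift_monomial]
  exact DFunLike.congr_fun this f

theorem shift_add (l m : Fin n → ℕ) (f : HardySpace n E) :
    shift (l + m) f = shift l (shift m f) := by
  have : (shift (l + m) : HardySpace n E →ₗᵢ[ℂ] _).toContinuousLinearMap =
      (shift l).toContinuousLinearMap ∘L (shift m).toContinuousLinearMap :=
    hardySpace_ext fun k η => by
      simp [shift_monomial, add_assoc, add_comm m l]
  exact DFunLike.congr_fun this f

/-- Purity of the shifts: a multiple of `z_i ^ (k i + 1)` has no coefficient at `k`. -/
theorem eq_zero_of_forall_mem_range_shift (i : Fin n) {f : HardySpace n E}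
    (h : ∀ N : ℕ, ∃ g, f = shift (Pi.single i N) g) : f = 0 := by
  refine eq_zero_of_forall_inner_monomial fun k η => ?_
  obtain ⟨g, rfl⟩ := h (k i + 1)
  have hs := ((hasSum_monomial g).map (shift (Pi.single i (k i + 1))).toContinuousLinearMap
    (ContinuousLinearMap.continuous _)).mapL (innerSL ℂ (monomial k η))
  refine hs.unique ?_
  convert hasSum_zero with m
  simp only [Function.comp, LinearIsometry.coe_toContinuousLinearMap, shift_monomial,
    innerSL_apply_apply]
  refine inner_monomial_monomial_of_ne (fun hk => ?_) _ _
  have := congrFun hk i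
  simp at this
  omega

theorem adjoint_shift_monomial_of_eq_zero {k : Fin n → ℕ} {i : Fin n} (hk : k i = 0) (η : E) :
    (ContinuousLinearMap.adjoint
      (shift (Pi.single i 1) : HardySpace n E →ₗᵢ[ℂ] _).toContinuousLinearMap)
        (monomial k η) = 0 := by
  refine eq_zero_of_forall_inner_monomial fun l ξ => ?_
  rw [ContinuousLinearMap.adjoint_inner_right, LinearIsometry.coe_toContinuousLinearMap,
    shift_monomial]
  refine inner_monomial_monomial_of_ne (fun h => ?_) _ _
  have := congrFun h i
  simp [hk] at this

theorem adjoint_comp_self {H G : Type*} [NormedAddCommGroup H] [InnerProductSpace ℂ H]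
    [CompleteSpace H] [NormedAddCommGroup G] [InnerProductSpace ℂ G] [CompleteSpace G]
    (V : H →ₗᵢ[ℂ] G) (x : H) :
    ContinuousLinearMap.adjoint V.toContinuousLinearMap (V x) = x := by
  refine ext_inner_left ℂ fun y => ?_
  rw [ContinuousLinearMap.adjoint_inner_right]
  exact V.inner_map_map y x

theorem exists_eq_add_single {k : Fin n → ℕ} {i : Fin n} (hk : k i ≠ 0) :
    ∃ l : Fin n → ℕ, k = l + Pi.single i 1 := by
  refine ⟨k - Pi.single i 1, (tsub_add_cancel_of_le ?_).symm⟩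
  intro j
  by_cases h : j = i
  · subst h; simpa using Nat.one_le_iff_ne_zero.2 hk
  · simp [h]

/-- On monomials, the backward shift in direction `i` lowers the `i`-th exponent, or gives zero if
that exponent is zero; multiplication by another variable does not interfere. -/
theorem adjoint_shift_comm {i j : Fin n} (hij : i ≠ j) (f : HardySpace n E) :
    ContinuousLinearMap.adjoint (shift (Pi.single i 1)).toContinuousLinearMap
        (shift (Pi.single j 1) f) =
      shift (Pi.single j 1)
        (ContinuousLinearMap.adjoint (shift (Pi.single i 1)).toContinuousLinearMap f) := by
  have : ContinuousLinearMap.adjoint (shift (Pi.single i 1)).toContinuousLinearMap ∘L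
      (shift (Pi.single j 1) : HardySpace n E →ₗᵢ[ℂ] _).toContinuousLinearMap =
      (shift (Pi.single j 1)).toContinuousLinearMap ∘L
      ContinuousLinearMap.adjoint (shift (Pi.single i 1)).toContinuousLinearMap := by
    refine hardySpace_ext fun k η => ?_
    simp only [ContinuousLinearMap.comp_apply, LinearIsometry.coe_toContinuousLinearMap,
      shift_monomial]
    by_cases hk : k i = 0
    · rw [adjoint_shift_monomial_of_eq_zero hk, map_zero, adjoint_shift_monomial_of_eq_zero]
      simp [hk, hij]
    · obtain ⟨l, rfl⟩ := exists_eq_add_single hk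
      rw [add_right_comm, ← shift_monomial, adjoint_comp_self, ← shift_monomial (Pi.single i 1) l,
        adjoint_comp_self, shift_monomial]
  exact DFunLike.congr_fun this f

/-! ### Evaluation -/

/-- Evaluation at a point of the polydisc. -/
def evalCLM {z : Fin n → ℂ} (hz : z ∈ polydisc n) : HardySpace n E →L[ℂ] E :=
  LinearMap.mkContinuous
    { toFun := fun f => f.eval z
      map_add' := fun f g => by
        refine (HardySpace.hasSum_eval (f + g) hz).unique ?_
        convert (HardySpace.hasSum_eval f hz).add (HardySpace.hasSum_eval g hz) using 1
        funext k
        simp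
      map_smul' := fun c f => by
        refine (HardySpace.hasSum_eval (c • f) hz).unique ?_
        convert (HardySpace.hasSum_eval f hz).const_smul c using 1
        funext k
        simp [smul_comm c]
        rfl }
    (∑' k : Fin n → ℕ, ‖∏ i, z i ^ k i‖)
    fun f => by
      have hs := (summable_monomial hz).mul_right ‖f‖
      rw [← tsum_mul_right]
      refine tsum_of_norm_bounded hs.hasSum fun k => ?_
      rw [norm_smul]
      gcongr
      exact lp.norm_apply_le_norm (by norm_num) f k

theorem evalCLM_apply {z : Fin n → ℂ} (hz : z ∈ polydisc n) (f : HardySpace n E) :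
    evalCLM hz f = f.eval z := rfl

theorem eval_shift {z : Fin n → ℂ} (hz : z ∈ polydisc n) (l : Fin n → ℕ) (f : HardySpace n E) :
    (shift l f).eval z = (∏ i, z i ^ l i) • f.eval z := by
  have : evalCLM hz ∘L (shift l).toContinuousLinearMap =
      (∏ i, z i ^ l i) • (evalCLM hz : HardySpace n E →L[ℂ] E) :=
    hardySpace_ext fun k η => by
      simp [shift_monomial, evalCLM_apply, eval_monomial, smul_smul, pow_add,
        Finset.prod_mul_distrib, mul_comm]
  exact DFunLike.congr_fun this f

/-- The Szegő kernel `∑ k, conj(w ^ k) z ^ k η`. -/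
def szegoKernel {w : Fin n → ℂ} (hw : w ∈ polydisc n) (η : E) : HardySpace n E :=
  ContinuousLinearMap.adjoint (evalCLM hw) η

theorem szegoKernel_apply {w : Fin n → ℂ} (hw : w ∈ polydisc n) (η : E) (k : Fin n → ℕ) :
    szegoKernel hw η k = (starRingEnd ℂ) (∏ i, w i ^ k i) • η := by
  refine ext_inner_left ℂ fun ξ : E => ?_
  rw [← inner_monomial_left, szegoKernel, ContinuousLinearMap.adjoint_inner_right, evalCLM_apply,
    eval_monomial, inner_smul_left, inner_smul_right]

theorem summable_norm_monomial_sq {w : Fin n → ℂ} (hw : w ∈ polydisc n) :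
    Summable fun k : Fin n → ℕ => ‖∏ i, w i ^ k i‖ ^ 2 := by
  refine (summable_monomial hw).of_nonneg_of_le (fun _ => by positivity) fun k => ?_
  refine pow_le_of_le_one (norm_nonneg _) ?_ two_ne_zero
  rw [norm_prod]
  refine Finset.prod_le_one (fun _ _ => norm_nonneg _) fun i _ => ?_
  rw [norm_pow]
  exact pow_le_one₀ (norm_nonneg _) (hw i).le

theorem eval_szegoKernel {w : Fin n → ℂ} (hw : w ∈ polydisc n) (η : E) :
    (szegoKernel hw η).eval w = ((∑' k : Fin n → ℕ, ‖∏ i, w i ^ k i‖ ^ 2 : ℝ) : ℂ) • η := by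
  refine (HardySpace.hasSum_eval _ hw).unique ?_
  have h := (Complex.hasSum_ofReal.2 (summable_norm_monomial_sq hw).hasSum).smul_const η
  convert h using 1
  funext k
  rw [szegoKernel_apply, smul_smul, Complex.mul_conj, Complex.normSq_eq_norm_sq]

theorem norm_sq_szegoKernel {w : Fin n → ℂ} (hw : w ∈ polydisc n) (η : E) :
    ‖szegoKernel hw η‖ ^ 2 = (∑' k : Fin n → ℕ, ‖∏ i, w i ^ k i‖ ^ 2) * ‖η‖ ^ 2 := by
  have h : inner ℂ (szegoKernel hw η) (szegoKernel hw η) =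
      inner ℂ η ((szegoKernel hw η).eval w) := by
    rw [← evalCLM_apply hw, ← ContinuousLinearMap.adjoint_inner_left, ← szegoKernel]
  rw [eval_szegoKernel, inner_smul_right, inner_self_eq_norm_sq_to_K,
    inner_self_eq_norm_sq_to_K] at h
  refine Complex.ofReal_injective ?_
  push_cast at h ⊢
  exact h

/-- Cauchy–Schwarz against the Szegő kernel in the direction `f(w)`, whose inner product with `f` is
`‖f(w)‖ ^ 2`. -/
theorem norm_sq_eval_le {w : Fin n → ℂ} (hw : w ∈ polydisc n) (f : HardySpace n E) :
    ‖f.eval w‖ ^ 2 ≤ (∑' k : Fin n → ℕ, ‖∏ i, w i ^ k i‖ ^ 2) * ‖f‖ ^ 2 := by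
  set c := ∑' k : Fin n → ℕ, ‖∏ i, w i ^ k i‖ ^ 2
  have h : inner ℂ (szegoKernel hw (f.eval w)) f = inner ℂ (f.eval w) (f.eval w) := by
    rw [szegoKernel, ContinuousLinearMap.adjoint_inner_left, evalCLM_apply]
  have h1 : ‖f.eval w‖ ^ 2 ≤ ‖szegoKernel hw (f.eval w)‖ * ‖f‖ := by
    have := norm_inner_le_norm (𝕜 := ℂ) (szegoKernel hw (f.eval w)) f
    rw [h, inner_self_eq_norm_sq_to_K] at this
    simpa using this
  by_cases h0 : ‖f.eval w‖ ^ 2 = 0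
  · rw [h0]
    exact mul_nonneg (tsum_nonneg fun _ => by positivity) (by positivity)
  have h2 := pow_le_pow_left₀ (by positivity) h1 2
  rw [mul_pow, norm_sq_szegoKernel hw] at h2
  have hp : 0 < ‖f.eval w‖ ^ 2 := lt_of_le_of_ne (by positivity) (Ne.symm h0)
  nlinarith

/-- The symbol of a contractive multiplication operator is contractive. -/
theorem norm_symbol_le {F : Type*} [NormedAddCommGroup F] [InnerProductSpace ℂ F]
    [CompleteSpace F] {Ψ : (Fin n → ℂ) → F →L[ℂ] E} {M : HardySpace n F →L[ℂ] HardySpace n E}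
    (hM : IsMultiplicationOperator Ψ M) (hn : ∀ f, ‖M f‖ ≤ ‖f‖) {z : Fin n → ℂ}
    (hz : z ∈ polydisc n) (η : F) : ‖Ψ z η‖ ≤ ‖η‖ := by
  -- At its own point the kernel takes the value `c η`, and its squared norm is `c ‖η‖ ^ 2`. The
  -- evaluation bound for its image thus reads `c ^ 2 ‖Ψ z η‖ ^ 2 ≤ c ^ 2 ‖η‖ ^ 2`.
  have h := hM (szegoKernel hz η) z hz
  have h1 := norm_sq_eval_le hz (M (szegoKernel hz η))
  set c := ∑' k : Fin n → ℕ, ‖∏ i, z i ^ k i‖ ^ 2 with hc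
  have hcpos : 0 < c := by
    refine (summable_norm_monomial_sq hz).tsum_pos (fun _ => by positivity) 0 ?_
    simp
  have h2 : ‖M (szegoKernel hz η)‖ ^ 2 ≤ c * ‖η‖ ^ 2 := by
    rw [← norm_sq_szegoKernel hz]
    exact pow_le_pow_left₀ (norm_nonneg _) (hn _) 2
  rw [h, eval_szegoKernel, map_smul, norm_smul, mul_pow, ← hc, Complex.norm_real,
    Real.norm_of_nonneg hcpos.le] at h1
  refine le_of_sq_le_sq ?_ (norm_nonneg _)
  have h3 : c ^ 2 * ‖Ψ z η‖ ^ 2 ≤ c ^ 2 * ‖η‖ ^ 2 := by nlinarith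
  exact le_of_mul_le_mul_left h3 (by positivity)

end

section

/-! ### Doubly commuting pure isometries -/

open ContinuousLinearMap

variable {n : ℕ} {K : Type*} [NormedAddCommGroup K] [InnerProductSpace ℂ K] [CompleteSpace K]

/-- A semigroup of isometries indexed by `ℕⁿ` whose generators are pure and doubly commuting. -/
structure IsDoublyCommuting (R : (Fin n → ℕ) → K →ₗᵢ[ℂ] K) : Prop where
  map_zero : ∀ x, R 0 x = x
  map_add : ∀ k l x, R (k + l) x = R k (R l x)
  adjoint_comm : ∀ i j x, i ≠ j → adjoint (R (Pi.single i 1)).toContinuousLinearMap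
      (R (Pi.single j 1) x) =
    R (Pi.single j 1) (adjoint (R (Pi.single i 1)).toContinuousLinearMap x)
  pure : ∀ i x, (∀ N : ℕ, ∃ y, x = R (Pi.single i N) y) → x = 0

/-- The joint kernel of the adjoints of the generators. -/
def wandering (R : (Fin n → ℕ) → K →ₗᵢ[ℂ] K) : Submodule ℂ K :=
  ⨅ i, LinearMap.ker (adjoint (R (Pi.single i 1)).toContinuousLinearMap).toLinearMap

theorem mem_wandering {R : (Fin n → ℕ) → K →ₗᵢ[ℂ] K} {x : K} :
    x ∈ wandering R ↔ ∀ i, adjoint (R (Pi.single i 1)).toContinuousLinearMap x = 0 := by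
  simp [wandering, Submodule.mem_iInf]

instance (R : (Fin n → ℕ) → K →ₗᵢ[ℂ] K) : CompleteSpace (wandering R) := by
  have : IsClosed (wandering R : Set K) := by
    rw [wandering, Submodule.coe_iInf]
    exact isClosed_iInter fun i => ContinuousLinearMap.isClosed_ker _
  exact this.completeSpace_coe

namespace IsDoublyCommuting

variable {R : (Fin n → ℕ) → K →ₗᵢ[ℂ] K} (hR : IsDoublyCommuting R)
include hR

theorem adjoint_apply_of_eq_zero {i : Fin n} {k : Fin n → ℕ} (hk : k i = 0) (x : K) :
    adjoint (R (Pi.single i 1)).toContinuousLinearMap (R k x) =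
      R k (adjoint (R (Pi.single i 1)).toContinuousLinearMap x) := by
  induction hs : ∑ j, k j generalizing k x with
  | zero =>
    have : k = 0 := by
      funext j
      exact Finset.sum_eq_zero_iff.1 hs j (Finset.mem_univ j)
    rw [this, hR.map_zero, hR.map_zero]
  | succ s ih =>
    obtain ⟨j, hj⟩ : ∃ j, k j ≠ 0 := by
      by_contra! h
      simp [h] at hs
    have hij : i ≠ j := by rintro rfl; exact hj hk
    obtain ⟨l, rfl⟩ := exists_eq_add_single hj
    rw [hR.map_add, hR.map_add, ih, hR.adjoint_comm i j x hij]
    · simpa [hij] using hk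
    · simpa [Finset.sum_add_distrib] using hs

/-- Cancel `k i` copies of the `i`-th generator on both sides. The right vector still has a factor
of that generator, and the adjoint of this factor passes through the remaining `R` on the left and
kills `w`. -/
theorem inner_eq_zero_of_lt {i : Fin n} {k l : Fin n → ℕ} (h : k i < l i) {w : K}
    (hw : w ∈ wandering R) (v : K) : inner ℂ (R k w) (R l v) = 0 := by
  have e1 : k = Pi.single i (k i) + (k - Pi.single i (k i)) := by
    refine (add_tsub_cancel_of_le fun j => ?_).symm
    by_cases hj : j = i
    · subst hj; simp
    · simp [hj]
  have e2 : l = Pi.single i (k i) + (Pi.single i 1 + (l - Pi.single i (k i + 1))) := by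
    funext j
    by_cases hj : j = i
    · subst hj; simp; omega
    · simp [hj]
  have f1 : R k w = R (Pi.single i (k i)) (R (k - Pi.single i (k i)) w) := by
    rw [← hR.map_add, ← e1]
  have f2 : R l v =
      R (Pi.single i (k i)) (R (Pi.single i 1) (R (l - Pi.single i (k i + 1)) v)) := by
    rw [← hR.map_add, ← hR.map_add, add_assoc, ← e2]
  rw [f1, f2, LinearIsometry.inner_map_map,
    ← LinearIsometry.coe_toContinuousLinearMap (R (Pi.single i 1)), ← adjoint_inner_left,
    hR.adjoint_apply_of_eq_zero (by simp), mem_wandering.1 hw i]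
  simp

theorem orthogonalFamily : OrthogonalFamily ℂ (fun _ : Fin n → ℕ => wandering R)
    fun k => (R k).comp (wandering R).subtypeₗᵢ := by
  intro k l hkl w v
  change inner ℂ (R k w) (R l v) = 0
  obtain ⟨i, hi⟩ := Function.ne_iff.1 hkl
  rcases lt_or_gt_of_ne hi with h | h
  · exact hR.inner_eq_zero_of_lt h w.2 v
  · rw [← inner_conj_symm, hR.inner_eq_zero_of_lt h v.2 w, _root_.map_zero]

theorem adjoint_adjoint_comm (i j : Fin n) (x : K) :
    adjoint (R (Pi.single i 1)).toContinuousLinearMap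
      (adjoint (R (Pi.single j 1)).toContinuousLinearMap x) =
    adjoint (R (Pi.single j 1)).toContinuousLinearMap
      (adjoint (R (Pi.single i 1)).toContinuousLinearMap x) := by
  refine ext_inner_left ℂ fun y => ?_
  simp only [adjoint_inner_right, LinearIsometry.coe_toContinuousLinearMap]
  rw [← hR.map_add, ← hR.map_add, add_comm]

/-- A nonzero `x` orthogonal to all translates of the wandering space is changed, one coordinate at
a time, into a nonzero vector with the same orthogonality that lies in the wandering space. For `k =
0` this vector is orthogonal to itself. -/
theorem eq_zero_of_orthogonal {x : K} (hx : ∀ k, ∀ w ∈ wandering R, inner ℂ (R k w) x = 0) :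
    x = 0 := by
  have key : ∀ A : Finset (Fin n), ∀ x : K, x ≠ 0 →
      (∀ k, ∀ w ∈ wandering R, inner ℂ (R k w) x = 0) →
      ∃ y : K, y ≠ 0 ∧ (∀ k, ∀ w ∈ wandering R, inner ℂ (R k w) y = 0) ∧
        ∀ i ∈ A, adjoint (R (Pi.single i 1)).toContinuousLinearMap y = 0 := by
    intro A x h0 hx
    induction A using Finset.induction_on with
    | empty => exact ⟨x, h0, hx, by simp⟩
    | insert j A hj ih =>
      obtain ⟨y, hy0, hy, hyA⟩ := ih
      set B := adjoint (R (Pi.single j 1)).toContinuousLinearMap with hB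
      have h1 : ∀ N : ℕ, ∀ k, ∀ w ∈ wandering R, inner ℂ (R k w) (B^[N] y) = 0 := by
        intro N
        induction N with
        | zero => exact hy
        | succ N ihN =>
          intro k w hw
          rw [Function.iterate_succ_apply', hB, adjoint_inner_right,
            LinearIsometry.coe_toContinuousLinearMap, ← hR.map_add]
          exact ihN _ w hw
      have h2 : ∀ N : ℕ, ∀ i ∈ A,
          adjoint (R (Pi.single i 1)).toContinuousLinearMap (B^[N] y) = 0 := by
        intro N i hi
        induction N with
        | zero => exact hyA i hi
        | succ N ihN =>
          rw [Function.iterate_succ_apply', hB, hR.adjoint_adjoint_comm, ← hB, ihN,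
            _root_.map_zero]
      -- The projection `1 - R_j R_j*` lands in the kernel of `R_j* = B`. If it killed every `B^[N]
      -- y`, then `y = R_j ^ N (B^[N] y)` for all `N`, contrary to purity.
      obtain ⟨N, hN⟩ : ∃ N : ℕ, B^[N] y - R (Pi.single j 1) (B (B^[N] y)) ≠ 0 := by
        by_contra! hcon
        refine hy0 (hR.pure j y fun N => ⟨B^[N] y, ?_⟩)
        induction N with
        | zero => simp [hR.map_zero]
        | succ N ihN =>
          rw [Function.iterate_succ_apply', Pi.single_add, hR.map_add,
            ← sub_eq_zero.1 (hcon N)]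
          exact ihN
      refine ⟨_, hN, fun k w hw => ?_, fun i hi => ?_⟩
      · rw [inner_sub_right, h1 N k w hw, zero_sub, neg_eq_zero]
        -- If `k j = 0`, then `R k w` is orthogonal to the range of `R_j`; otherwise one factor
        -- `R_j` cancels and the orthogonality to `B^[N + 1] y` applies.
        by_cases hk : k j = 0
        · rw [← LinearIsometry.coe_toContinuousLinearMap (R (Pi.single j 1)),
            ← adjoint_inner_left, hR.adjoint_apply_of_eq_zero hk, mem_wandering.1 hw j]
          simp
        · obtain ⟨l, rfl⟩ := exists_eq_add_single hk
          rw [add_comm, hR.map_add, LinearIsometry.inner_map_map, ← Function.iterate_succ_apply' B]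
          exact h1 (N + 1) l w hw
      · rcases Finset.mem_insert.1 hi with rfl | hiA
        · rw [map_sub, adjoint_comp_self, sub_self]
        · have hij : i ≠ j := by rintro rfl; exact hj hiA
          rw [map_sub, h2 N i hiA, hR.adjoint_comm i j _ hij, hB, hR.adjoint_adjoint_comm, ← hB,
            h2 N i hiA]
          simp
  by_contra h0
  obtain ⟨y, hy0, hy, hyA⟩ := key Finset.univ x h0 hx
  have := hy 0 y (mem_wandering.2 fun i => hyA i (Finset.mem_univ i))
  rw [hR.map_zero] at this
  exact hy0 (inner_self_eq_zero.1 this)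

/-- The **Wold decomposition** of doubly commuting pure isometries. -/
theorem isHilbertSum : IsHilbertSum ℂ (fun _ : Fin n → ℕ => wandering R)
    fun k => (R k).comp (wandering R).subtypeₗᵢ := by
  refine IsHilbertSum.mk hR.orthogonalFamily (top_le_iff.2 ?_)
  rw [Submodule.topologicalClosure_eq_top_iff, Submodule.eq_bot_iff]
  intro x hx
  refine hR.eq_zero_of_orthogonal fun k w hw => ?_
  refine (Submodule.mem_orthogonal _ _).1 hx _ ?_
  exact Submodule.mem_iSup_of_mem k ⟨⟨w, hw⟩, rfl⟩

end IsDoublyCommuting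

end

/-! ### Multi-index induction and constant operators -/

section

theorem multiIndex_induction {n : ℕ} {P : (Fin n → ℕ) → Prop} (h0 : P 0)
    (h1 : ∀ k i, P k → P (Pi.single i 1 + k)) (k : Fin n → ℕ) : P k := by
  induction hs : ∑ j, k j generalizing k with
  | zero =>
    have : k = 0 := by
      funext j
      exact Finset.sum_eq_zero_iff.1 hs j (Finset.mem_univ j)
    rwa [this]
  | succ s ih =>
    obtain ⟨j, hj⟩ : ∃ j, k j ≠ 0 := by
      by_contra! h
      simp [h] at hs
    obtain ⟨l, rfl⟩ := exists_eq_add_single hj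
    rw [add_comm]
    exact h1 l j (ih l (by simpa [Finset.sum_add_distrib] using hs))

theorem constantOperator_monomial {n : ℕ} {F : Type*} [NormedAddCommGroup F]
    [InnerProductSpace ℂ F] (U : F →L[ℂ] F) (k : Fin n → ℕ) (η : F) :
    constantOperator n U (monomial k η) = monomial k (U η) := by
  ext l
  by_cases h : l = k
  · subst h; simp [constantOperator, monomial_eq]
  · simp [constantOperator, monomial_eq, h]

/-! ### Partial isometries with a Toeplitz property -/

open ContinuousLinearMap

section

variable {H : Type u} [NormedAddCommGroup H] [InnerProductSpace ℂ H] [CompleteSpace H]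

/-- `V V*` is the projection onto the range of `V`, and a vector whose norm `V*` preserves lies in
that range. -/
theorem apply_adjoint_of_norm_eq {G : Type*} [NormedAddCommGroup G] [InnerProductSpace ℂ G]
    [CompleteSpace G] (V : G →ₗᵢ[ℂ] H) {z : H}
    (h : ‖adjoint V.toContinuousLinearMap z‖ = ‖z‖) :
    V (adjoint V.toContinuousLinearMap z) = z := by
  have h1 : inner ℂ (V (adjoint V.toContinuousLinearMap z)) z = ((‖z‖ ^ 2 : ℝ) : ℂ) := by
    rw [← LinearIsometry.coe_toContinuousLinearMap, ← adjoint_inner_right,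
      inner_self_eq_norm_sq_to_K, h]
    push_cast
    rfl
  have h2 : ‖V (adjoint V.toContinuousLinearMap z) - z‖ ^ 2 = 0 := by
    rw [@norm_sub_sq ℂ, h1, V.norm_map, h, RCLike.re_to_complex, Complex.ofReal_re]
    ring
  exact sub_eq_zero.1 (norm_eq_zero.1 (pow_eq_zero_iff two_ne_zero |>.1 h2))

/-- The initial space of an operator. -/
def initialSpace (T : H →L[ℂ] H) : Submodule ℂ H := (LinearMap.ker T.toLinearMap)ᗮ

instance (T : H →L[ℂ] H) : CompleteSpace (initialSpace T) := by
  unfold initialSpace; infer_instance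

theorem adjoint_mem_initialSpace (T : H →L[ℂ] H) (x : H) : adjoint T x ∈ initialSpace T := by
  refine (Submodule.mem_orthogonal _ _).2 fun y hy => ?_
  have hy' : T y = 0 := hy
  rw [adjoint_inner_right, hy', inner_zero_left]

theorem apply_eq_zero_of_mem_orthogonal {T : H →L[ℂ] H} {x : H} (hx : x ∈ (initialSpace T)ᗮ) :
    T x = 0 := by
  refine ext_inner_right ℂ fun y => ?_
  rw [← adjoint_inner_right, inner_zero_left]
  exact (Submodule.mem_orthogonal' _ _).1 hx _ (adjoint_mem_initialSpace T y)

theorem exists_decomposition (T : H →L[ℂ] H) (x : H) :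
    ∃ y ∈ initialSpace T, ∃ z, T z = 0 ∧ z ∈ (initialSpace T)ᗮ ∧ x = y + z := by
  obtain ⟨y, hy, z, hz, h⟩ := (initialSpace T).exists_add_mem_mem_orthogonal x
  exact ⟨y, hy, z, apply_eq_zero_of_mem_orthogonal hz, hz, h⟩

/-- For normal `T` the kernels of `T` and `T*` coincide, so the range of `T` is orthogonal to `ker
T`. -/
theorem apply_mem_initialSpace {T : H →L[ℂ] H} (hn : IsStarNormal T) (x : H) :
    T x ∈ initialSpace T := by
  refine (Submodule.mem_orthogonal _ _).2 fun y hy => ?_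
  have hy' : T y = 0 := hy
  have h2 : adjoint T y = 0 := by
    have := (ContinuousLinearMap.isStarNormal_iff_norm_eq_adjoint (T := T)).1 hn y
    rw [hy', norm_zero] at this
    exact norm_eq_zero.1 this.symm
  rw [← adjoint_inner_left, h2, inner_zero_left]

namespace IsPartialIsometry

variable {T : H →L[ℂ] H} (hT : IsPartialIsometry T)
include hT

omit [CompleteSpace H] in
theorem inner_map_map {f g : H} (hf : f ∈ initialSpace T) (hg : g ∈ initialSpace T) :
    inner ℂ (T f) (T g) = inner ℂ f g := by
  let V : initialSpace T →ₗᵢ[ℂ] H := ⟨T.toLinearMap ∘ₗ (initialSpace T).subtype, fun x => hT x x.2⟩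
  exact V.inner_map_map ⟨f, hf⟩ ⟨g, hg⟩

theorem norm_le (x : H) : ‖T x‖ ≤ ‖x‖ := by
  obtain ⟨y, hy, z, hz, hzo, rfl⟩ := exists_decomposition T x
  rw [map_add, hz, add_zero, hT y hy]
  have h := norm_add_sq_eq_norm_sq_add_norm_sq_of_inner_eq_zero y z
    ((Submodule.mem_orthogonal _ _).1 hzo y hy)
  refine (mul_self_le_mul_self_iff (norm_nonneg _) (norm_nonneg _)).2 ?_
  linarith [mul_self_nonneg ‖z‖]

/-- By Pythagoras, a nonzero component in the kernel would strictly decrease the norm. -/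
theorem mem_of_norm_eq {x : H} (h : ‖T x‖ = ‖x‖) : x ∈ initialSpace T := by
  obtain ⟨y, hy, z, hz, hzo, rfl⟩ := exists_decomposition T x
  rw [map_add, hz, add_zero, hT y hy] at h
  have h2 := norm_add_sq_eq_norm_sq_add_norm_sq_of_inner_eq_zero y z
    ((Submodule.mem_orthogonal _ _).1 hzo y hy)
  rw [← h] at h2
  have : z = 0 := norm_eq_zero.1 (mul_self_eq_zero.1 (by linarith))
  rwa [this, add_zero]

theorem adjoint_apply_apply {f : H} (hf : f ∈ initialSpace T) : adjoint T (T f) = f := by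
  refine ext_inner_right ℂ fun x => ?_
  obtain ⟨y, hy, z, hz, hzo, rfl⟩ := exists_decomposition T x
  rw [adjoint_inner_left, map_add, hz, add_zero, hT.inner_map_map hf hy, inner_add_right,
    (Submodule.mem_orthogonal _ _).1 hzo f hf, add_zero]

theorem apply_adjoint_apply (hn : IsStarNormal T) {f : H} (hf : f ∈ initialSpace T) :
    T (adjoint T f) = f := by
  have h := DFunLike.congr_fun hn.star_comm_self.eq f
  exact h.symm.trans (hT.adjoint_apply_apply hf)

/-- In `‖f‖ = ‖T f‖ = ‖V* T V f‖ ≤ ‖T V f‖ ≤ ‖V f‖ = ‖f‖` all terms agree. The last inequality being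
sharp puts `V f` in the initial space; the first being sharp puts `T V f` in the range of `V`, so `T
V f = V V* T V f = V T f`. -/
theorem mem_and_comm {V : H →ₗᵢ[ℂ] H}
    (hV : ∀ x, adjoint V.toContinuousLinearMap (T (V x)) = T x) {f : H}
    (hf : f ∈ initialSpace T) : V f ∈ initialSpace T ∧ T (V f) = V (T f) := by
  have h1 : ‖T f‖ ≤ ‖T (V f)‖ := by
    rw [← hV f]
    refine (le_opNorm _ _).trans (mul_le_of_le_one_left (norm_nonneg _) ?_)
    rw [LinearIsometryEquiv.norm_map]
    exact V.norm_toContinuousLinearMap_le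
  have h2 := hT.norm_le (V f)
  have h3 : ‖T f‖ = ‖f‖ := hT f hf
  have h4 : ‖V f‖ = ‖f‖ := V.norm_map f
  refine ⟨hT.mem_of_norm_eq (by linarith), ?_⟩
  rw [← hV f]
  refine (apply_adjoint_of_norm_eq V ?_).symm
  rw [hV f]
  linarith

end IsPartialIsometry

end

/-! ### The model of a normal partial isometry -/

section

variable {n : ℕ} {H : Type u} [NormedAddCommGroup H] [InnerProductSpace ℂ H] [CompleteSpace H]
  {R : (Fin n → ℕ) → H →ₗᵢ[ℂ] H} {T : H →L[ℂ] H}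

theorem IsPartialIsometry.mem_and_comm_semigroup (hR : IsDoublyCommuting R)
    (hT : IsPartialIsometry T)
    (hB : ∀ i x, adjoint (R (Pi.single i 1)).toContinuousLinearMap (T (R (Pi.single i 1) x)) = T x)
    {f : H} (hf : f ∈ initialSpace T) (k : Fin n → ℕ) :
    R k f ∈ initialSpace T ∧ T (R k f) = R k (T f) := by
  induction k using multiIndex_induction with
  | h0 => simpa [hR.map_zero] using hf
  | h1 k i ih =>
    rw [hR.map_add, hR.map_add, ← ih.2]
    exact hT.mem_and_comm (hB i) ih.1

/-- The restriction of a semigroup of isometries to an invariant subspace. -/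
def restrictIsometry (R : (Fin n → ℕ) → H →ₗᵢ[ℂ] H) (K : Submodule ℂ H)
    (h : ∀ k, ∀ f ∈ K, R k f ∈ K) (k : Fin n → ℕ) : K →ₗᵢ[ℂ] K where
  toLinearMap := (R k).toLinearMap.restrict (h k)
  norm_map' f := (R k).norm_map f

omit [CompleteSpace H] in
theorem coe_restrictIsometry (R : (Fin n → ℕ) → H →ₗᵢ[ℂ] H) (K : Submodule ℂ H)
    (h : ∀ k, ∀ f ∈ K, R k f ∈ K) (k : Fin n → ℕ) (f : K) :
    (restrictIsometry R K h k f : H) = R k f := rfl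

/-- The adjoint of a restricted shift is the compression of `R_i*` to the initial space. The
projection in it is invisible to `T`, which vanishes on the orthogonal complement, so the double
commutation of `R` can be used after applying `T`. Normality plays no role. -/
theorem IsPartialIsometry.isDoublyCommuting_restrict (hR : IsDoublyCommuting R)
    (hT : IsPartialIsometry T)
    (hB : ∀ i x, adjoint (R (Pi.single i 1)).toContinuousLinearMap (T (R (Pi.single i 1) x)) = T x)
    (h : ∀ k, ∀ f ∈ initialSpace T, R k f ∈ initialSpace T) :
    IsDoublyCommuting (restrictIsometry R (initialSpace T) h) := by
  set Q := restrictIsometry R (initialSpace T) h with hQ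
  have hadj : ∀ (i : Fin n) (x y : initialSpace T),
      inner ℂ (adjoint (Q (Pi.single i 1)).toContinuousLinearMap x : H) (y : H) =
        inner ℂ (x : H) (R (Pi.single i 1) y) := fun i x y =>
    adjoint_inner_left (Q (Pi.single i 1)).toContinuousLinearMap y x
  have hTadj : ∀ (i : Fin n) (x : initialSpace T),
      T (adjoint (R (Pi.single i 1)).toContinuousLinearMap x) =
        T (adjoint (Q (Pi.single i 1)).toContinuousLinearMap x : H) := by
    intro i x
    rw [← sub_eq_zero, ← map_sub]
    refine apply_eq_zero_of_mem_orthogonal ((Submodule.mem_orthogonal' _ _).2 fun y hy => ?_)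
    rw [inner_sub_left, adjoint_inner_left, LinearIsometry.coe_toContinuousLinearMap, sub_eq_zero]
    exact (hadj i x ⟨y, hy⟩).symm
  -- It suffices that `Q_j` preserves `ker Q_i*`. For `g = Q_i* Q_j f` one finds `R_j* T g = R_j* T
  -- R_j R_i* f = T R_i* f = T Q_i* f = 0`. Hence `‖g‖ ^ 2 = ⟪R_i g, R_j f⟫ = ⟪R_i T g, R_j T f⟫ =
  -- ⟪R_i R_j* T g, T f⟫ = 0`.
  have key : ∀ i j : Fin n, i ≠ j → ∀ f : initialSpace T,
      adjoint (Q (Pi.single i 1)).toContinuousLinearMap f = 0 →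
      adjoint (Q (Pi.single i 1)).toContinuousLinearMap (Q (Pi.single j 1) f) = 0 := by
    intro i j hij f hf
    set g := adjoint (Q (Pi.single i 1)).toContinuousLinearMap (Q (Pi.single j 1) f) with hg
    have h1 : adjoint (R (Pi.single j 1)).toContinuousLinearMap (T g) = 0 := by
      rw [hg, ← hTadj, hQ, coe_restrictIsometry, hR.adjoint_comm i j _ hij, hB, hTadj, hf]
      simp
    have h2 : inner ℂ (R (Pi.single j 1) (T f)) (R (Pi.single i 1) (T g)) = 0 := by
      rw [← LinearIsometry.coe_toContinuousLinearMap (R (Pi.single j 1)), ← adjoint_inner_right,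
        hR.adjoint_comm j i _ hij.symm, h1, _root_.map_zero, inner_zero_right]
    rw [← (hT.mem_and_comm (hB j) f.2).2, ← (hT.mem_and_comm (hB i) g.2).2,
      hT.inner_map_map (h _ _ f.2) (h _ _ g.2)] at h2
    have h3 := hadj i (Q (Pi.single j 1) f) g
    rw [← hg, hQ, coe_restrictIsometry, h2] at h3
    exact Subtype.ext (inner_self_eq_zero.1 h3)
  refine ⟨fun x => Subtype.ext (hR.map_zero x), fun k l x => Subtype.ext (hR.map_add k l x),
    fun i j x hij => ?_, fun i x hx => ?_⟩
  · set y := adjoint (Q (Pi.single i 1)).toContinuousLinearMap x with hy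
    -- Split `x` into `Q_i Q_i* x` and a vector of `ker Q_i*`; on the range of `Q_i` the relation
    -- only needs that `Q_i` and `Q_j` commute.
    have h1 := key i j hij (x - Q (Pi.single i 1) y) (by
      rw [map_sub, adjoint_comp_self, ← hy, sub_self])
    have h2 : Q (Pi.single j 1) (Q (Pi.single i 1) y) =
        Q (Pi.single i 1) (Q (Pi.single j 1) y) := by
      refine Subtype.ext ?_
      simp only [hQ, coe_restrictIsometry]
      rw [← hR.map_add, ← hR.map_add, add_comm]
    rw [map_sub, map_sub, h2, adjoint_comp_self] at h1
    exact sub_eq_zero.1 h1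
  · refine Subtype.ext (hR.pure i x fun N => ?_)
    obtain ⟨y, hy⟩ := hx N
    exact ⟨y, congrArg Subtype.val hy⟩

/-- A normal partial isometry with the Toeplitz property with respect to doubly commuting pure
isometries is unitarily equivalent to a constant operator on a Hardy space, compressed to its
initial space. -/
theorem IsPartialIsometry.exists_model (hR : IsDoublyCommuting R) (hT : IsPartialIsometry T)
    (hn : IsStarNormal T)
    (hB : ∀ i x, adjoint (R (Pi.single i 1)).toContinuousLinearMap (T (R (Pi.single i 1) x)) =
      T x) :
    ∃ (F : Type u) (_ : NormedAddCommGroup F) (_ : InnerProductSpace ℂ F) (_ : CompleteSpace F)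
      (V : HardySpace n F →ₗᵢ[ℂ] H) (U : unitary (F →L[ℂ] F)),
      (∀ k η, V (monomial k η) = R k (V (monomial 0 η))) ∧
        T = V.toContinuousLinearMap ∘L constantOperator n (U : F →L[ℂ] F) ∘L
          adjoint V.toContinuousLinearMap := by
  have hK := fun k (f : H) (hf : f ∈ initialSpace T) => (hT.mem_and_comm_semigroup hR hB hf k).1
  have hc := fun k (f : H) (hf : f ∈ initialSpace T) => (hT.mem_and_comm_semigroup hR hB hf k).2
  have hQ := hT.isDoublyCommuting_restrict hR hB hK
  set Q := restrictIsometry R (initialSpace T) hK with hQdef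
  have hmem : ∀ x : initialSpace T,
      x ∈ wandering Q ↔ ∀ (i : Fin n) (y : initialSpace T),
        inner ℂ (x : H) (R (Pi.single i 1) y) = 0 := by
    intro x
    rw [mem_wandering]
    refine forall_congr' fun i => ⟨fun h y => ?_, fun h => ext_inner_right ℂ fun y => ?_⟩
    · have := adjoint_inner_left (Q (Pi.single i 1)).toContinuousLinearMap y x
      rw [h, inner_zero_left] at this
      exact this.symm
    · rw [adjoint_inner_left, inner_zero_left]
      exact h y
  have hU : ∀ w : wandering Q,
      (⟨T (w : initialSpace T), apply_mem_initialSpace hn _⟩ : initialSpace T) ∈ wandering Q := by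
    intro w
    refine (hmem _).2 fun i y => ?_
    -- With `y = T T* y` and `T` commuting with `R_i`, the inner product becomes `⟪T w, T R_i T* y⟫
    -- = ⟪w, R_i T* y⟫`.
    have hy := hT.apply_adjoint_apply hn y.2
    rw [← hy, ← hc _ _ (adjoint_mem_initialSpace T _)]
    refine (hT.inner_map_map w.1.2 (hK _ _ (adjoint_mem_initialSpace T _))).trans ?_
    exact (hmem w.1).1 w.2 i ⟨_, adjoint_mem_initialSpace T _⟩
  have hU' : ∀ w : wandering Q,
      (⟨adjoint T (w : initialSpace T), adjoint_mem_initialSpace T _⟩ : initialSpace T) ∈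
        wandering Q := by
    intro w
    refine (hmem _).2 fun i y => ?_
    rw [adjoint_inner_left, hc _ _ y.2]
    exact (hmem w.1).1 w.2 i ⟨_, apply_mem_initialSpace hn _⟩
  let U : wandering Q ≃ₗᵢ[ℂ] wandering Q :=
    { toFun := fun w => ⟨_, hU w⟩
      invFun := fun w => ⟨_, hU' w⟩
      map_add' := fun w v => Subtype.ext (Subtype.ext (map_add T _ _))
      map_smul' := fun c w => Subtype.ext (Subtype.ext (map_smul T _ _))
      left_inv := fun w => Subtype.ext (Subtype.ext (hT.adjoint_apply_apply w.1.2))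
      right_inv := fun w => Subtype.ext (Subtype.ext (hT.apply_adjoint_apply hn w.1.2))
      norm_map' := fun w => hT w w.1.2 }
  have hUc : ∀ w : wandering Q, ((U w : initialSpace T) : H) = T (w : initialSpace T) :=
    fun w => rfl
  let V : HardySpace n (wandering Q) →ₗᵢ[ℂ] H :=
    (initialSpace T).subtypeₗᵢ.comp hQ.orthogonalFamily.linearIsometry
  have hV : ∀ k w, V (monomial k w) = R k (w : initialSpace T) := fun k w =>
    congrArg Subtype.val (hQ.orthogonalFamily.linearIsometry_apply_single (i := k) w)
  set W : wandering Q →L[ℂ] wandering Q := (Unitary.linearIsometryEquiv.symm U).1 with hW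
  have hTV : T ∘L V.toContinuousLinearMap = V.toContinuousLinearMap ∘L constantOperator n W := by
    refine hardySpace_ext fun k w => ?_
    simp only [coe_comp, Function.comp, LinearIsometry.coe_toContinuousLinearMap,
      constantOperator_monomial]
    rw [hV, hV, hc k _ w.1.2]
    rfl
  -- On the complement of the initial space both sides vanish; the initial space itself is the range
  -- of `V` by the Wold decomposition.
  have hfin : ∀ x, T x = V (constantOperator n W (adjoint V.toContinuousLinearMap x)) := by
    intro x
    obtain ⟨y, hy, z, hz, hzo, rfl⟩ := exists_decomposition T x
    have hz' : adjoint V.toContinuousLinearMap z = 0 := by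
      refine ext_inner_left ℂ fun f => ?_
      rw [adjoint_inner_right, inner_zero_right]
      have hf : V f ∈ initialSpace T := Subtype.prop (hQ.orthogonalFamily.linearIsometry f)
      exact (Submodule.mem_orthogonal _ _).1 hzo _ hf
    obtain ⟨g, hg⟩ := hQ.isHilbertSum.surjective_isometry ⟨y, hy⟩
    have hg' : V g = y := congrArg Subtype.val hg
    rw [map_add, map_add, hz, hz', add_zero, add_zero, ← hg', adjoint_comp_self]
    exact DFunLike.congr_fun hTV g
  refine ⟨wandering Q, inferInstance, inferInstance, inferInstance, V,
    Unitary.linearIsometryEquiv.symm U, fun k w => ?_, ?_⟩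
  · rw [hV, hV, hR.map_zero]
  · exact ContinuousLinearMap.ext hfin

end

end

section

/-! ### Poisson integrals on the circle -/

/-- A bound for the Poisson kernel by a sum of multiples of indicators of dyadic intervals. -/
theorem ofReal_div_le_tsum_indicator {δ s : ℝ} (hδ : 0 < δ) :
    ENNReal.ofReal (2 * δ / (δ ^ 2 + s ^ 2)) ≤
      ∑' j : ℕ, (Set.Iic (2 ^ j * δ)).indicator
        (fun _ => ENNReal.ofReal (8 * (1 / 2) ^ j) / ENNReal.ofReal (2 ^ j * δ)) s := by
  have hex : ∃ j : ℕ, s ≤ 2 ^ j * δ := by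
    obtain ⟨j, hj⟩ := pow_unbounded_of_one_lt (s / δ) one_lt_two
    exact ⟨j, ((div_lt_iff₀ hδ).1 hj).le⟩
  classical
  -- The first dyadic interval that contains `s`. For `j ≥ 1` minimality gives `s > 2 ^ (j - 1) δ`,
  -- so the kernel is at most `2 / (4 ^ (j - 1) δ) = 8 (1 / 2) ^ j / (2 ^ j δ)`.
  set j := Nat.find hex with hj
  have h1 : s ≤ 2 ^ j * δ := Nat.find_spec hex
  refine le_trans ?_ (ENNReal.le_tsum j)
  rw [Set.indicator_of_mem (by exact h1), ← ENNReal.ofReal_div_of_pos (by positivity)]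
  refine ENNReal.ofReal_le_ofReal ?_
  rw [div_le_div_iff₀ (by positivity) (by positivity)]
  have h2 : ((1 : ℝ) / 2) ^ j * 2 ^ j = 1 := by rw [← mul_pow]; norm_num
  rcases Nat.eq_zero_or_pos j with h0 | h0
  · rw [h0]
    nlinarith [sq_nonneg s]
  · obtain ⟨m, hm⟩ : ∃ m, j = m + 1 := ⟨j - 1, by omega⟩
    have h3 : 2 ^ m * δ < s := by
      have := Nat.find_min hex (m := m) (by omega)
      linarith
    have h4 : (2 : ℝ) ^ j = 2 * 2 ^ m := by rw [hm, pow_succ]; ring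
    have h5 : (2 ^ m * δ) ^ 2 ≤ s ^ 2 := pow_le_pow_left₀ (by positivity) h3.le 2
    have h6 : (1 / 2 : ℝ) ^ j * (2 ^ j) ^ 2 = 2 ^ j := by
      rw [sq, ← mul_assoc, h2, one_mul]
    have hp : (0 : ℝ) < (1 / 2) ^ j := by positivity
    have h7 : (2 : ℝ) ^ j * δ * (2 * δ) = 8 * ((1 / 2 : ℝ) ^ j * (2 ^ m * δ) ^ 2) := by
      rw [← h6, h4]; ring
    nlinarith [mul_le_mul_of_nonneg_left h5 hp.le, mul_nonneg hp.le (sq_nonneg δ)]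

/-- The dyadic bound dominates the integral by `∑ 8 (1 / 2) ^ j A (2 ^ j δ)`, where `A h` is the
mass of the ball of radius `h` divided by `h`. Since `A` is bounded, for small `h` by `hA` and for
large `h` by the finite total mass, dominated convergence applies to the sum. -/
theorem tendsto_lintegral_poisson_bound {φ : UnitAddCircle → ℝ≥0∞} (hφ : AEMeasurable φ)
    (hfin : ∫⁻ s, φ s ≠ ∞)
    (hA : Tendsto (fun h : ℝ => (∫⁻ s in Metric.closedBall 0 h, φ s) / ENNReal.ofReal h)
      (𝓝[>] 0) (𝓝 0)) :
    Tendsto (fun δ : ℝ => ∫⁻ s, ENNReal.ofReal (2 * δ / (δ ^ 2 + ‖s‖ ^ 2)) * φ s)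
      (𝓝[>] 0) (𝓝 0) := by
  set A : ℝ → ℝ≥0∞ := fun h => (∫⁻ s in Metric.closedBall 0 h, φ s) / ENNReal.ofReal h with hAdef
  have hbd : ∃ B : ℝ≥0∞, B ≠ ∞ ∧ ∀ h, 0 < h → A h ≤ B := by
    have h1 : ∀ᶠ h in 𝓝[>] (0 : ℝ), A h ≤ 1 := hA.eventually_le_const one_pos
    obtain ⟨h0, h0pos, hh⟩ := (mem_nhdsGT_iff_exists_Ioo_subset (a := (0 : ℝ))).1 h1
    have h0pos : 0 < h0 := h0pos
    refine ⟨max 1 ((∫⁻ s, φ s) / ENNReal.ofReal h0), ?_, fun h hpos => ?_⟩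
    · refine (max_lt ENNReal.one_lt_top ?_).ne
      exact ENNReal.div_lt_top hfin (by simpa using h0pos)
    · by_cases hlt : h < h0
      · exact le_max_of_le_left (hh ⟨hpos, hlt⟩)
      · refine le_max_of_le_right ?_
        exact ENNReal.div_le_div (setLIntegral_le_lintegral _ _)
          (ENNReal.ofReal_le_ofReal (not_lt.1 hlt))
  obtain ⟨B, hB, hAB⟩ := hbd
  have hmain : ∀ δ : ℝ, 0 < δ →
      ∫⁻ s, ENNReal.ofReal (2 * δ / (δ ^ 2 + ‖s‖ ^ 2)) * φ s ≤
        ∑' j : ℕ, ENNReal.ofReal (8 * (1 / 2) ^ j) * A (2 ^ j * δ) := by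
    intro δ hδ
    calc ∫⁻ s, ENNReal.ofReal (2 * δ / (δ ^ 2 + ‖s‖ ^ 2)) * φ s
        ≤ ∫⁻ s, ∑' j : ℕ, (Metric.closedBall (0 : UnitAddCircle) (2 ^ j * δ)).indicator
          (fun s => ENNReal.ofReal (8 * (1 / 2) ^ j) / ENNReal.ofReal (2 ^ j * δ) * φ s) s := by
          refine lintegral_mono fun s => ?_
          refine (mul_le_mul_left (ofReal_div_le_tsum_indicator hδ) _).trans ?_
          rw [← ENNReal.tsum_mul_right]
          refine ENNReal.tsum_le_tsum fun j => ?_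
          simp only [Set.indicator, Set.mem_Iic, Metric.mem_closedBall, dist_zero_right]
          split_ifs <;> simp
      _ = ∑' j : ℕ, ENNReal.ofReal (8 * (1 / 2) ^ j) * A (2 ^ j * δ) := by
          rw [lintegral_tsum]
          · refine tsum_congr fun j => ?_
            rw [lintegral_indicator Metric.isClosed_closedBall.measurableSet,
              lintegral_const_mul'' _ hφ.restrict, hAdef]
            simp only [div_eq_mul_inv]
            ring
          · exact fun j => (hφ.const_mul _).indicator Metric.isClosed_closedBall.measurableSet
  have hlim : Tendsto (fun δ : ℝ => ∑' j : ℕ, ENNReal.ofReal (8 * (1 / 2) ^ j) * A (2 ^ j * δ))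
      (𝓝[>] 0) (𝓝 0) := by
    have hz : (0 : ℝ≥0∞) = ∫⁻ _ : ℕ, (0 : ℝ≥0∞) ∂Measure.count := by simp
    simp only [← lintegral_count]
    rw [hz]
    refine tendsto_lintegral_filter_of_dominated_convergence
      (fun j : ℕ => ENNReal.ofReal (8 * (1 / 2) ^ j) * B) (.of_forall fun δ => .of_discrete) ?_ ?_ ?_
    · filter_upwards [self_mem_nhdsWithin] with δ hδ
      have hδ : 0 < δ := hδ
      exact .of_forall fun j => mul_le_mul_right (hAB _ (by positivity)) _
    · rw [lintegral_count, ENNReal.tsum_mul_right]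
      refine ENNReal.mul_ne_top ?_ hB
      have hs : Summable fun j : ℕ => 8 * (1 / 2 : ℝ) ^ j := summable_geometric_two.mul_left 8
      rw [← ENNReal.ofReal_tsum_of_nonneg (fun _ => by positivity) hs]
      exact ENNReal.ofReal_ne_top
    · refine .of_forall fun j => ?_
      have hsc : Tendsto (fun δ : ℝ => 2 ^ j * δ) (𝓝[>] 0) (𝓝[>] 0) := by
        refine tendsto_nhdsWithin_iff.2 ⟨?_, ?_⟩
        · have : Tendsto (fun δ : ℝ => 2 ^ j * δ) (𝓝 0) (𝓝 (2 ^ j * 0)) :=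
            (continuous_const.mul continuous_id).tendsto _
          rw [mul_zero] at this
          exact this.mono_left nhdsWithin_le_nhds
        · filter_upwards [self_mem_nhdsWithin] with δ hδ
          have hδ : 0 < δ := hδ
          show 0 < 2 ^ j * δ
          positivity
      have := ENNReal.Tendsto.const_mul (a := ENNReal.ofReal (8 * (1 / 2) ^ j))
        (hA.comp hsc) (Or.inr ENNReal.ofReal_ne_top)
      simpa using this
  refine tendsto_of_tendsto_of_tendsto_of_le_of_le' tendsto_const_nhds hlim
    (.of_forall fun _ => zero_le) ?_
  filter_upwards [self_mem_nhdsWithin] with δ hδ using hmain δ hδ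

/-- The Poisson kernel of the unit disc with pole at `r`. -/
def circlePoisson (r : ℝ) (s : UnitAddCircle) : ℝ :=
  poissonKernel 0 r (AddCircle.toCircle s : ℂ)

theorem circlePoisson_eq (r : ℝ) (s : UnitAddCircle) :
    circlePoisson r s = (1 - r ^ 2) / ‖(AddCircle.toCircle s : ℂ) - r‖ ^ 2 := by
  simp [circlePoisson, poissonKernel_def, Circle.norm_coe]

theorem toCircle_sub_ne_zero {r : ℝ} (h0 : 0 ≤ r) (h1 : r < 1) (s : UnitAddCircle) :
    (AddCircle.toCircle s : ℂ) - r ≠ 0 := by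
  intro h
  have := congrArg norm (sub_eq_zero.1 h)
  rw [Circle.norm_coe, Complex.norm_real, Real.norm_of_nonneg h0] at this
  linarith

theorem continuous_circlePoisson {r : ℝ} (h0 : 0 ≤ r) (h1 : r < 1) :
    Continuous (circlePoisson r) := by
  simp only [funext (circlePoisson_eq r)]
  refine continuous_const.div ?_ fun s => ?_
  · exact ((continuous_subtype_val.comp AddCircle.continuous_toCircle).sub
      continuous_const).norm.pow 2
  · exact pow_ne_zero 2 (norm_ne_zero_iff.2 (toCircle_sub_ne_zero h0 h1 s))

theorem circlePoisson_nonneg {r : ℝ} (h0 : 0 ≤ r) (h1 : r < 1) (s : UnitAddCircle) :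
    0 ≤ circlePoisson r s := by
  rw [circlePoisson_eq]
  exact div_nonneg (by nlinarith) (by positivity)

/-- With `y` the representative of `s` in `[-1/2, 1/2]`, the denominator is `(1 - r) ^ 2 + 2 r (1 -
cos 2πy)`, and `1 - cos x ≥ 2 x ^ 2 / π ^ 2` for `|x| ≤ π`. The assumption `1 / 2 ≤ r` keeps the
factor `2 r` away from zero. -/
theorem circlePoisson_le {r : ℝ} (h0 : 1 / 2 ≤ r) (h1 : r < 1) (s : UnitAddCircle) :
    circlePoisson r s ≤ 2 * (1 - r) / ((1 - r) ^ 2 + ‖s‖ ^ 2) := by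
  rw [circlePoisson_eq]
  have hden : (1 - r) ^ 2 + ‖s‖ ^ 2 ≤ ‖(AddCircle.toCircle s : ℂ) - r‖ ^ 2 := by
    obtain ⟨x, rfl⟩ := QuotientAddGroup.mk_surjective s
    have hx : ((x - round x : ℝ) : UnitAddCircle) = (x : UnitAddCircle) := by
      have h1 : ((round x : ℝ) : UnitAddCircle) = 0 := by
        have := AddCircle.coe_zsmul (p := (1 : ℝ)) (n := round x) (x := 1)
        simp only [zsmul_eq_mul, mul_one] at this
        rw [this, AddCircle.coe_period, smul_zero]
      rw [AddCircle.coe_sub, h1, sub_zero]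
    have hn : ‖(x : UnitAddCircle)‖ = |x - round x| := UnitAddCircle.norm_eq
    change (1 - r) ^ 2 + ‖(x : UnitAddCircle)‖ ^ 2 ≤
      ‖(AddCircle.toCircle (x : UnitAddCircle) : ℂ) - r‖ ^ 2
    rw [hn, ← hx, sq_abs, AddCircle.toCircle_apply_mk]
    set y := x - round x
    have hy : |y| ≤ 1 / 2 := abs_sub_round x
    have hc := Real.cos_le_one_sub_mul_cos_sq (x := 2 * Real.pi / 1 * y) (by
      rw [abs_mul, div_one, abs_of_pos Real.two_pi_pos]
      nlinarith [Real.pi_pos])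
    have he : ‖((Circle.exp (2 * Real.pi / 1 * y) : Circle) : ℂ) - r‖ ^ 2 =
        1 - 2 * r * Real.cos (2 * Real.pi / 1 * y) + r ^ 2 := by
      rw [← Complex.normSq_eq_norm_sq, Circle.coe_exp, Complex.exp_mul_I, Complex.normSq_apply]
      simp only [Complex.sub_re, Complex.add_re, Complex.mul_re, Complex.I_re, Complex.I_im,
        Complex.ofReal_re, Complex.ofReal_im, Complex.cos_ofReal_re, Complex.sin_ofReal_im,
        Complex.sub_im, Complex.add_im, Complex.mul_im, Complex.cos_ofReal_im,
        Complex.sin_ofReal_re]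
      nlinarith [Real.sin_sq_add_cos_sq (2 * Real.pi / 1 * y)]
    have h8 : 2 / Real.pi ^ 2 * (2 * Real.pi / 1 * y) ^ 2 = 8 * y ^ 2 := by
      have := Real.pi_ne_zero
      field_simp
      ring
    rw [he]
    rw [h8] at hc
    nlinarith [sq_nonneg y]
  refine div_le_div₀ (by nlinarith) (by nlinarith) ?_ hden
  nlinarith [sq_nonneg ‖s‖]

/-- The Poisson formula for the holomorphic function `z ^ m` at `r`; Hardy functions need no
negative exponents. -/
theorem integral_circlePoisson_smul_pow {r : ℝ} (h0 : 0 ≤ r) (h1 : r < 1) (m : ℕ) :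
    ∫ s : UnitAddCircle, circlePoisson r s • (AddCircle.toCircle s : ℂ) ^ m = (r : ℂ) ^ m := by
  have hd : DiffContOnCl ℂ (fun z : ℂ => z ^ m) (Metric.ball 0 1) :=
    (differentiable_pow m).diffContOnCl
  have h := hd.circleAverage_poissonKernel_smul (w := (r : ℂ)) (by
    simpa [abs_of_nonneg h0] using h1)
  rw [← h, Real.circleAverage_def, ← UnitAddCircle.intervalIntegral_preimage 0, zero_add]
  have hs := intervalIntegral.integral_comp_mul_left
    (fun θ => (poissonKernel 0 (r : ℂ) • fun z : ℂ => z ^ m) (circleMap 0 1 θ))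
    (a := 0) (b := 1) (c := 2 * Real.pi) Real.two_pi_pos.ne'
  rw [mul_zero, mul_one] at hs
  rw [← hs]
  refine intervalIntegral.integral_congr fun x _ => ?_
  have hx : (AddCircle.toCircle (x : UnitAddCircle) : ℂ) = circleMap 0 1 (2 * Real.pi * x) := by
    rw [AddCircle.toCircle_apply_mk, Circle.coe_exp]
    simp [circleMap]
  simp only [circlePoisson, hx, Pi.smul_apply']

theorem integral_circlePoisson {r : ℝ} (h0 : 0 ≤ r) (h1 : r < 1) :
    ∫ s : UnitAddCircle, circlePoisson r s = 1 := by
  have := integral_circlePoisson_smul_pow h0 h1 0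
  simp only [pow_zero, Complex.real_smul, mul_one] at this
  rw [integral_complex_ofReal] at this
  exact_mod_cast this

variable {E : Type*} [NormedAddCommGroup E]

theorem integrable_circlePoisson_smul [NormedSpace ℝ E] {r : ℝ} (h0 : 0 ≤ r) (h1 : r < 1)
    {g : UnitAddCircle → E} (hg : Integrable g) :
    Integrable fun s => circlePoisson r s • g s := by
  obtain ⟨C, hC⟩ := isCompact_univ.exists_bound_of_continuousOn
    (continuous_circlePoisson h0 h1).continuousOn
  exact hg.bdd_smul C (continuous_circlePoisson h0 h1).aestronglyMeasurable
    (.of_forall fun s => hC s (Set.mem_univ s))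

theorem ae_tendsto_lintegral_closedBall {g : UnitAddCircle → E} (hg : Integrable g) :
    ∀ᵐ x, Tendsto (fun h : ℝ => (∫⁻ s in Metric.closedBall 0 h, ‖g (x + s) - g x‖ₑ) /
      ENNReal.ofReal h) (𝓝[>] 0) (𝓝 0) := by
  filter_upwards [IsUnifLocDoublingMeasure.ae_tendsto_average_norm_sub volume
    hg.locallyIntegrable 1] with x hx
  have h1 := hx (fun _ : ℝ => x) (fun h => h) (tendsto_id (α := ℝ) (x := 𝓝[>] 0)) (by
    filter_upwards [self_mem_nhdsWithin] with h hh
    have hh : 0 < h := hh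
    simpa using hh.le)
  -- A ball of radius `h ≤ 1 / 2` has measure `2 h`, whereas the statement divides by `h`.
  have h2 := ENNReal.tendsto_ofReal (h1.const_mul 2)
  rw [mul_zero, ENNReal.ofReal_zero] at h2
  refine h2.congr' ?_
  filter_upwards [Ioo_mem_nhdsGT (show (0 : ℝ) < 1 / 2 by norm_num)] with h hh
  have hint : IntegrableOn (fun y => ‖g y - g x‖) (Metric.closedBall x h) :=
    (hg.sub (integrable_const _)).norm.integrableOn
  rw [setAverage_eq, smul_eq_mul, measureReal_def, AddCircle.volume_closedBall,
    min_eq_right (by linarith [hh.2]), ENNReal.toReal_ofReal (by linarith [hh.1])]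
  rw [show 2 * ((2 * h)⁻¹ * ∫ y in Metric.closedBall x h, ‖g y - g x‖) =
    (∫ y in Metric.closedBall x h, ‖g y - g x‖) / h by have := hh.1.ne'; field_simp,
    ENNReal.ofReal_div_of_pos hh.1,
    ofReal_integral_eq_lintegral_ofReal hint (.of_forall fun _ => norm_nonneg _)]
  congr 1
  rw [← lintegral_indicator Metric.isClosed_closedBall.measurableSet,
    ← lintegral_indicator Metric.isClosed_closedBall.measurableSet,
    ← lintegral_add_left_eq_self _ x]
  refine lintegral_congr fun s => ?_
  simp [Set.indicator, ofReal_norm]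

/-- **Fatou's theorem** for Poisson integrals on the circle. -/
theorem ae_tendsto_integral_circlePoisson [NormedSpace ℝ E] [CompleteSpace E]
    {g : UnitAddCircle → E} (hg : Integrable g) :
    ∀ᵐ x, Tendsto (fun r : ℝ => ∫ s, circlePoisson r s • g (x + s)) (𝓝[<] 1) (𝓝 (g x)) := by
  filter_upwards [ae_tendsto_lintegral_closedBall hg] with x hx
  have hgx : Integrable fun s => g (x + s) := hg.comp_add_left x
  have hd : Integrable fun s => g (x + s) - g x := hgx.sub (integrable_const _)
  have h1 := tendsto_lintegral_poisson_bound hd.1.enorm hd.2.ne hx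
  have hr : Tendsto (fun r : ℝ => 1 - r) (𝓝[<] 1) (𝓝[>] 0) := by
    refine tendsto_nhdsWithin_iff.2 ⟨?_, ?_⟩
    · have : Tendsto (fun r : ℝ => 1 - r) (𝓝 1) (𝓝 (1 - 1)) :=
        (continuous_const.sub continuous_id).tendsto _
      rw [sub_self] at this
      exact this.mono_left nhdsWithin_le_nhds
    · filter_upwards [self_mem_nhdsWithin] with r hr
      exact sub_pos.2 (Set.mem_Iio.1 hr)
  have h2 := h1.comp hr
  rw [tendsto_iff_edist_tendsto_0]
  refine tendsto_of_tendsto_of_tendsto_of_le_of_le' tendsto_const_nhds h2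
    (.of_forall fun _ => zero_le) ?_
  filter_upwards [Ioo_mem_nhdsLT (show (1 / 2 : ℝ) < 1 by norm_num)] with r hr
  have hr0 : 0 ≤ r := by linarith [hr.1]
  -- The kernel has total mass one, so `g x` can be moved under the integral.
  have he : (∫ s, circlePoisson r s • g (x + s)) - g x =
      ∫ s, circlePoisson r s • (g (x + s) - g x) := by
    simp only [smul_sub]
    rw [integral_sub (integrable_circlePoisson_smul hr0 hr.2 hgx)
      (integrable_circlePoisson_smul hr0 hr.2 (integrable_const _)), integral_smul_const,
      integral_circlePoisson hr0 hr.2, one_smul]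
  rw [edist_eq_enorm_sub, he]
  refine (enorm_integral_le_lintegral_enorm _).trans (lintegral_mono fun s => ?_)
  rw [enorm_smul, Real.enorm_of_nonneg (circlePoisson_nonneg hr0 hr.2 s)]
  exact mul_le_mul_left (ENNReal.ofReal_le_ofReal (circlePoisson_le hr.1.le hr.2 s)) _

end

section

/-! ### Analyticity of power series on the polydisc -/

theorem polydisc_eq_ball (n : ℕ) : polydisc n = Metric.ball 0 1 := by
  ext z
  simp [polydisc, pi_norm_lt_iff]

theorem norm_monomial_le {n : ℕ} {z : Fin n → ℂ} {σ : ℝ} (hz : ‖z‖ ≤ σ) (k : Fin n → ℕ) :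
    ‖∏ i, z i ^ k i‖ ≤ ∏ i, σ ^ k i := by
  rw [norm_prod]
  refine Finset.prod_le_prod (fun _ _ => norm_nonneg _) fun i _ => ?_
  rw [norm_pow]
  exact pow_le_pow_left₀ (norm_nonneg _) ((norm_le_pi_norm z i).trans hz) _

theorem summable_prod_pow {n : ℕ} {σ : ℝ} (h0 : 0 ≤ σ) (h1 : σ < 1) :
    Summable fun k : Fin n → ℕ => ∏ i, σ ^ k i := by
  have hz : (fun _ => (σ : ℂ)) ∈ polydisc n := fun i => by
    simpa [abs_of_nonneg h0] using h1
  refine (summable_monomial hz).congr fun k => ?_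
  simp [norm_prod, abs_of_nonneg h0]

/-- A power series with bounded coefficients is analytic on the polydisc. -/
theorem differentiableOn_tsum_monomial {n : ℕ} {G : Type*} [NormedAddCommGroup G]
    [NormedSpace ℂ G] [CompleteSpace G] {A : (Fin n → ℕ) → G} {C : ℝ} (hA : ∀ k, ‖A k‖ ≤ C) :
    DifferentiableOn ℂ (fun z : Fin n → ℂ => ∑' k, (∏ i, z i ^ k i) • A k) (polydisc n) := by
  intro z hz
  rw [polydisc_eq_ball, mem_ball_zero_iff] at hz
  obtain ⟨ρ, hzρ, hρ1⟩ := exists_between hz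
  obtain ⟨σ, hρσ, hσ1⟩ := exists_between hρ1
  have hσ0 : 0 ≤ σ := (norm_nonneg z).trans (hzρ.le.trans hρσ.le)
  have hC : 0 ≤ C := (norm_nonneg _).trans (hA 0)
  have hd : ∀ k : Fin n → ℕ, Differentiable ℂ fun z : Fin n → ℂ => (∏ i, z i ^ k i) • A k :=
    fun k => by fun_prop
  have hbound : ∀ k : Fin n → ℕ, ∀ y : Fin n → ℂ, ‖y‖ ≤ σ →
      ‖(∏ i, y i ^ k i) • A k‖ ≤ (∏ i, σ ^ k i) * C := fun k y hy => by
    rw [norm_smul]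
    exact mul_le_mul (norm_monomial_le hy k) (hA k) (norm_nonneg _)
      (Finset.prod_nonneg fun _ _ => by positivity)
  -- Cauchy's estimate on the ball of radius `σ - ρ` about a point of norm less than `ρ`: there each
  -- term varies by at most twice its bound on norm `σ`.
  have hsum : Summable fun k : Fin n → ℕ => (2 * ((∏ i, σ ^ k i) * C)) / (σ - ρ) :=
    (((summable_prod_pow hσ0 hσ1).mul_right C).mul_left 2).div_const _
  refine (hasFDerivAt_tsum_of_isPreconnected (𝕜 := ℂ) hsum (s := Metric.ball 0 ρ)
    Metric.isOpen_ball (convex_ball _ _).isPreconnected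
    (f' := fun k y => fderiv ℂ (fun z : Fin n → ℂ => (∏ i, z i ^ k i) • A k) y)
    (fun k y _ => (hd k y).hasFDerivAt) (fun k y hy => ?_) (x₀ := z) (by simpa using hzρ) ?_
    (by simpa using hzρ)).differentiableAt.differentiableWithinAt
  · rw [mem_ball_zero_iff] at hy
    refine Complex.norm_fderiv_le_div_of_mapsTo_ball (hd k).differentiableOn (fun w hw => ?_)
      (sub_pos.2 hρσ)
    rw [Metric.mem_ball, dist_eq_norm] at hw
    rw [Metric.mem_closedBall, dist_eq_norm]
    refine (norm_sub_le _ _).trans ?_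
    have hw' : ‖w‖ ≤ σ := by
      have := norm_sub_norm_le w y
      linarith
    linarith [hbound k w hw', hbound k y (hy.le.trans hρσ.le)]
  · refine Summable.of_norm_bounded ((summable_prod_pow hσ0 hσ1).mul_right C) fun k => ?_
    exact hbound k z (hzρ.le.trans hρσ.le)

variable {n : ℕ} {E : Type*} [NormedAddCommGroup E] [InnerProductSpace ℂ E] [CompleteSpace E]

theorem HardySpace.continuousOn_eval (f : HardySpace n E) : ContinuousOn f.eval (polydisc n) :=
  (differentiableOn_tsum_monomial fun k => lp.norm_apply_le_norm (by norm_num) f k).continuousOn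

end

section

/-! ### Radial boundary values on the torus -/

variable {n : ℕ} {E : Type*} [NormedAddCommGroup E] [InnerProductSpace ℂ E] [CompleteSpace E]

instance : (torusMeasure n).IsAddLeftInvariant := by
  unfold torusMeasure; infer_instance

/-- The diagonal translation of the torus by an element of the circle. -/
def rotate (t : UnitAddTorus (Fin n)) (s : UnitAddCircle) : UnitAddTorus (Fin n) :=
  fun i => s + t i

theorem continuous_rotate :
    Continuous fun p : UnitAddTorus (Fin n) × UnitAddCircle => rotate p.1 p.2 :=
  continuous_pi fun i => continuous_snd.add ((continuous_apply i).comp continuous_fst)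

theorem rotate_rotate (t : UnitAddTorus (Fin n)) (s s' : UnitAddCircle) :
    rotate (rotate t s) s' = rotate t (s + s') := by
  funext i
  simp only [rotate]
  abel

theorem lintegral_rotate {f : UnitAddTorus (Fin n) → ℝ≥0∞} (s : UnitAddCircle) :
    ∫⁻ t, f (rotate t s) ∂torusMeasure n = ∫⁻ t, f t ∂torusMeasure n :=
  lintegral_add_left_eq_self f (fun _ => s)

theorem lintegral_lintegral_rotate {f : UnitAddTorus (Fin n) → ℝ≥0∞} (hf : Measurable f) :
    ∫⁻ t, (∫⁻ s, f (rotate t s)) ∂torusMeasure n = ∫⁻ t, f t ∂torusMeasure n := by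
  have hm : AEMeasurable (Function.uncurry fun (t : UnitAddTorus (Fin n)) (s : UnitAddCircle) =>
      f (rotate t s)) ((torusMeasure n).prod volume) :=
    (hf.comp continuous_rotate.measurable).aemeasurable
  rw [lintegral_lintegral_swap hm]
  simp [lintegral_rotate]

/-- Transfers almost-everywhere statements between the torus and almost all points of almost all
diagonal circles. -/
theorem measurePreserving_rotate :
    MeasurePreserving (fun p : UnitAddTorus (Fin n) × UnitAddCircle => rotate p.1 p.2)
      ((torusMeasure n).prod volume) (torusMeasure n) := by
  refine ⟨continuous_rotate.measurable, Measure.ext fun A hA => ?_⟩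
  rw [Measure.map_apply continuous_rotate.measurable hA,
    Measure.prod_apply (continuous_rotate.measurable hA),
    ← lintegral_indicator_one hA, ← lintegral_lintegral_rotate (measurable_one.indicator hA)]
  refine lintegral_congr fun t => ?_
  rw [← lintegral_indicator_one
    (measurable_prodMk_left (continuous_rotate.measurable hA))]
  rfl

theorem torusPoint_rotate (t : UnitAddTorus (Fin n)) (s : UnitAddCircle) (i : Fin n) :
    torusPoint (rotate t s) i = AddCircle.toCircle s * torusPoint t i := by
  simp [torusPoint, rotate, AddCircle.toCircle_add]

/-- Along a diagonal circle a monomial is a one-variable power of its total degree, which reduces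
radial limits on the polydisc to the disc. -/
theorem torusMonomial_rotate (k : Fin n → ℕ) (t : UnitAddTorus (Fin n)) (s : UnitAddCircle) :
    torusMonomial k (rotate t s) = (AddCircle.toCircle s : ℂ) ^ (∑ i, k i) * torusMonomial k t := by
  simp [torusMonomial_apply, torusPoint_rotate, mul_pow, Finset.prod_mul_distrib,
    Finset.prod_pow_eq_pow_sum]

omit [CompleteSpace E] in
theorem eval_monomial_smul_torusPoint (k : Fin n → ℕ) (η : E) (r : ℝ)
    (t : UnitAddTorus (Fin n)) :
    (monomial k η : HardySpace n E).eval (r • torusPoint t) =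
      ((r : ℂ) ^ (∑ i, k i) * torusMonomial k t) • η := by
  rw [eval_monomial, torusMonomial_apply]
  simp [mul_pow, Finset.prod_mul_distrib, Finset.prod_pow_eq_pow_sum]

theorem boundary_monomial (k : Fin n → ℕ) (η : E) :
    boundary n E (monomial k η) = monomialEmbedding k η :=
  (orthogonalFamily_monomialEmbedding n E).linearIsometry_apply_single η

theorem boundary_monomial_ae (k : Fin n → ℕ) (η : E) :
    boundary n E (monomial k η) =ᵐ[torusMeasure n] fun t => torusMonomial k t • η := by
  rw [boundary_monomial]
  exact (memLp_monomial_smul k η).coeFn_toLp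

/-- A partial sum of the power series of `f`. -/
def partialSum (f : HardySpace n E) (A : Finset (Fin n → ℕ)) : HardySpace n E :=
  ∑ k ∈ A, monomial k (f k)

/-- The trigonometric polynomial of the boundary values of `partialSum`. -/
def partialSumBoundary (f : HardySpace n E) (A : Finset (Fin n → ℕ)) (t : UnitAddTorus (Fin n)) :
    E := ∑ k ∈ A, torusMonomial k t • f k

omit [CompleteSpace E] in
theorem continuous_partialSumBoundary (f : HardySpace n E) (A : Finset (Fin n → ℕ)) :
    Continuous (partialSumBoundary f A) := by
  unfold partialSumBoundary
  fun_prop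

theorem boundary_partialSum_ae (f : HardySpace n E) (A : Finset (Fin n → ℕ)) :
    boundary n E (partialSum f A) =ᵐ[torusMeasure n] partialSumBoundary f A := by
  classical
  induction A using Finset.induction_on with
  | empty =>
    simp only [partialSum, Finset.sum_empty, map_zero]
    filter_upwards [Lp.coeFn_zero E 2 (torusMeasure n)] with t ht
    rw [ht]
    simp [partialSumBoundary]
  | insert k A hk ih =>
    rw [partialSum, Finset.sum_insert hk, map_add]
    filter_upwards [Lp.coeFn_add (boundary n E (monomial k (f k)))
      (boundary n E (∑ k ∈ A, monomial k (f k))), boundary_monomial_ae k (f k), ih] with t h1 h2 h3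
    rw [h1, Pi.add_apply, h2, partialSumBoundary, Finset.sum_insert hk]
    congr 1

theorem eval_partialSum (f : HardySpace n E) (A : Finset (Fin n → ℕ)) {r : ℝ} (h0 : 0 < r)
    (h1 : r < 1) (t : UnitAddTorus (Fin n)) :
    (partialSum f A).eval (r • torusPoint t) =
      ∫ s, circlePoisson r s • partialSumBoundary f A (rotate t s) := by
  rw [← evalCLM_apply (smul_torusPoint_mem t h0 h1), partialSum, map_sum]
  simp only [partialSumBoundary, Finset.smul_sum]
  have hrot : Continuous fun s : UnitAddCircle => rotate t s :=
    continuous_rotate.comp (by fun_prop : Continuous fun s : UnitAddCircle => (t, s))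
  rw [integral_finsetSum]
  · refine Finset.sum_congr rfl fun k _ => ?_
    rw [evalCLM_apply, eval_monomial_smul_torusPoint]
    have : ∀ s, circlePoisson r s • torusMonomial k (rotate t s) • f k =
        ((circlePoisson r s • (AddCircle.toCircle s : ℂ) ^ (∑ i, k i)) * torusMonomial k t) •
          f k := fun s => by
      rw [torusMonomial_rotate, ← smul_assoc, smul_mul_assoc]
    simp only [this]
    rw [integral_smul_const, integral_mul_const, integral_circlePoisson_smul_pow h0.le h1]
  · intro k _
    refine integrable_circlePoisson_smul h0.le h1 ?_
    refine Continuous.integrable_of_hasCompactSupport ?_ (HasCompactSupport.of_compactSpace _)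
    exact ((torusMonomial k).continuous.comp hrot).smul continuous_const

theorem lintegral_enorm_boundary_sub_le (f : HardySpace n E) (A : Finset (Fin n → ℕ)) :
    ∫⁻ t, ‖boundary n E f t - partialSumBoundary f A t‖ₑ ∂torusMeasure n ≤
      ENNReal.ofReal ‖f - partialSum f A‖ := by
  have h1 : ∫⁻ t, ‖boundary n E f t - partialSumBoundary f A t‖ₑ ∂torusMeasure n =
      eLpNorm (boundary n E (f - partialSum f A)) 1 (torusMeasure n) := by
    rw [eLpNorm_one_eq_lintegral_enorm, map_sub]
    refine lintegral_congr_ae ?_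
    filter_upwards [Lp.coeFn_sub (boundary n E f) (boundary n E (partialSum f A)),
      boundary_partialSum_ae f A] with t h1 h2
    rw [h1, Pi.sub_apply, h2]
  rw [h1, ← (boundary n E).norm_map, Lp.norm_def, ENNReal.ofReal_toReal (Lp.eLpNorm_ne_top _)]
  exact eLpNorm_le_eLpNorm_of_exponent_le (by norm_num) (Lp.aestronglyMeasurable _)

/-- Elements of the Hardy space are the Poisson integrals of their boundary functions on almost
all diagonal circles. -/
theorem ae_eval_eq_integral_circlePoisson (f : HardySpace n E) :
    ∀ᵐ t ∂torusMeasure n, Integrable (fun s => boundary n E f (rotate t s)) ∧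
      ∀ r : ℝ, 0 < r → r < 1 → f.eval (r • torusPoint t) =
        ∫ s, circlePoisson r s • boundary n E f (rotate t s) := by
  -- The errors are chosen summable, so that the `L¹` errors `G N t` on the diagonal circle through
  -- `t` are summable for almost every `t`, hence tend to zero. This one null set serves all radii
  -- `r`.
  have hA : ∀ N : ℕ, ∃ A : Finset (Fin n → ℕ), ‖f - partialSum f A‖ < (1 / 2) ^ N := by
    intro N
    have := (Metric.tendsto_nhds.1 (hasSum_monomial f) ((1 / 2) ^ N) (by positivity)).exists
    obtain ⟨A, hA⟩ := this
    refine ⟨A, ?_⟩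
    rwa [dist_comm, dist_eq_norm] at hA
  choose A hA using hA
  have hbm : StronglyMeasurable (boundary n E f) := Lp.stronglyMeasurable _
  have hdm : ∀ N, StronglyMeasurable fun t =>
      boundary n E f t - partialSumBoundary f (A N) t := fun N =>
    hbm.sub (continuous_partialSumBoundary f (A N)).stronglyMeasurable
  set G : ℕ → UnitAddTorus (Fin n) → ℝ≥0∞ := fun N t =>
    ∫⁻ s, ‖boundary n E f (rotate t s) - partialSumBoundary f (A N) (rotate t s)‖ₑ with hG
  have hGm : ∀ N, Measurable (G N) := fun N =>
    ((hdm N).enorm.comp continuous_rotate.measurable).lintegral_prod_right'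
  have hGs : ∫⁻ t, ∑' N, G N t ∂torusMeasure n ≠ ∞ := by
    rw [lintegral_tsum fun N => (hGm N).aemeasurable]
    have hs : Summable fun N : ℕ => (1 / 2 : ℝ) ^ N := summable_geometric_two
    refine ne_top_of_le_ne_top (b := ∑' N : ℕ, ENNReal.ofReal ((1 / 2) ^ N)) ?_ ?_
    · rw [← ENNReal.ofReal_tsum_of_nonneg (fun _ => by positivity) hs]
      exact ENNReal.ofReal_ne_top
    · refine ENNReal.tsum_le_tsum fun N => ?_
      rw [hG]
      simp only
      rw [lintegral_lintegral_rotate (f := fun t =>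
        ‖boundary n E f t - partialSumBoundary f (A N) t‖ₑ) (hdm N).enorm]
      exact (lintegral_enorm_boundary_sub_le f (A N)).trans (ENNReal.ofReal_le_ofReal (hA N).le)
  have hGt := ae_lt_top (Measurable.tsum hGm) hGs
  filter_upwards [hGt] with t ht
  have hrot : Continuous fun s : UnitAddCircle => rotate t s :=
    continuous_rotate.comp (by fun_prop : Continuous fun s : UnitAddCircle => (t, s))
  have hlim : Tendsto (fun N => G N t) atTop (𝓝 0) :=
    ENNReal.tendsto_atTop_zero_of_tsum_ne_top ht.ne
  have hpi : ∀ N, Integrable fun s => partialSumBoundary f (A N) (rotate t s) := fun N =>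
    ((continuous_partialSumBoundary f (A N)).comp hrot).integrable_of_hasCompactSupport
      (HasCompactSupport.of_compactSpace _)
  have hbs : AEStronglyMeasurable fun s => boundary n E f (rotate t s) :=
    (hbm.comp_measurable hrot.measurable).aestronglyMeasurable
  have hbi : Integrable fun s => boundary n E f (rotate t s) := by
    have h0 : Integrable fun s =>
        boundary n E f (rotate t s) - partialSumBoundary f (A 0) (rotate t s) :=
      ⟨hbs.sub (hpi 0).1, (ENNReal.le_tsum 0).trans_lt ht⟩
    exact (h0.add (hpi 0)).congr (.of_forall fun s => sub_add_cancel _ _)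
  refine ⟨hbi, fun r h0 h1 => ?_⟩
  have hz := smul_torusPoint_mem t h0 h1
  have hf : Tendsto (fun N => partialSum f (A N)) atTop (𝓝 f) := by
    rw [tendsto_iff_norm_sub_tendsto_zero]
    refine squeeze_zero (fun _ => norm_nonneg _) (fun N => ?_)
      (tendsto_pow_atTop_nhds_zero_of_lt_one (r := (1 / 2 : ℝ)) (by norm_num) (by norm_num))
    rw [norm_sub_rev]
    exact (hA N).le
  have hl := ((evalCLM hz).continuous.tendsto f).comp hf
  refine tendsto_nhds_unique hl ?_
  simp only [Function.comp_def, evalCLM_apply, eval_partialSum f _ h0 h1]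
  obtain ⟨C, hC⟩ := isCompact_univ.exists_bound_of_continuousOn
    (continuous_circlePoisson h0.le h1).continuousOn
  refine tendsto_integral_of_L1 _ (integrable_circlePoisson_smul h0.le h1 hbi).1
    (.of_forall fun N => integrable_circlePoisson_smul h0.le h1 (hpi N)) ?_
  have hCl : Tendsto (fun N => ENNReal.ofReal C * G N t) atTop (𝓝 0) := by
    simpa using ENNReal.Tendsto.const_mul (a := ENNReal.ofReal C) hlim
      (Or.inr ENNReal.ofReal_ne_top)
  refine tendsto_of_tendsto_of_tendsto_of_le_of_le tendsto_const_nhds hCl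
    (fun _ => zero_le) fun N => ?_
  simp only [hG]
  rw [← lintegral_const_mul' _ _ ENNReal.ofReal_ne_top]
  refine lintegral_mono fun s => ?_
  simp only
  rw [← smul_sub, enorm_smul, ← enorm_neg (_ - _), neg_sub]
  refine mul_le_mul_left ?_ _
  rw [← ofReal_norm]
  exact ENNReal.ofReal_le_ofReal (hC s (Set.mem_univ s))

theorem continuous_eval_smul_torusPoint (f : HardySpace n E) {r : ℝ} (h0 : 0 < r) (h1 : r < 1) :
    Continuous fun t : UnitAddTorus (Fin n) => f.eval (r • torusPoint t) := by
  refine f.continuousOn_eval.comp_continuous ?_ fun t => smul_torusPoint_mem t h0 h1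
  have h : Continuous fun t : UnitAddTorus (Fin n) => torusPoint t := continuous_pi fun i =>
    continuous_subtype_val.comp (AddCircle.continuous_toCircle.comp (continuous_apply i))
  exact h.const_smul r

theorem continuousOn_eval_radial (f : HardySpace n E) (t : UnitAddTorus (Fin n)) :
    ContinuousOn (fun r : ℝ => f.eval (r • torusPoint t)) (Set.Ioo 0 1) :=
  f.continuousOn_eval.comp (by fun_prop) fun _ hr => smul_torusPoint_mem t hr.1 hr.2

/-- Fubini's theorem needs this set to be measurable. By continuity in `r`, the limit can be tested
on rational radii; the `M + 2` keeps these radii positive. -/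
theorem measurableSet_tendsto_eval (f : HardySpace n E) :
    MeasurableSet {t | Tendsto (fun r : ℝ => f.eval (r • torusPoint t)) (𝓝[<] 1)
      (𝓝 (boundary n E f t))} := by
  have hbm : StronglyMeasurable (boundary n E f) := Lp.stronglyMeasurable _
  have key : {t | Tendsto (fun r : ℝ => f.eval (r • torusPoint t)) (𝓝[<] 1)
      (𝓝 (boundary n E f t))} = ⋂ m : ℕ, ⋃ M : ℕ, ⋂ q : ℚ,
        ⋂ _ : (q : ℝ) ∈ Set.Ioo (1 - 1 / ((M : ℝ) + 2)) 1,
        {t | ‖f.eval ((q : ℝ) • torusPoint t) - boundary n E f t‖ ≤ 1 / ((m : ℝ) + 1)} := by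
    ext t
    simp only [Set.mem_ofPred_eq, Set.mem_iInter, Set.mem_iUnion]
    constructor
    · intro h m
      have h1 := (Metric.tendsto_nhds.1 h) (1 / ((m : ℝ) + 1)) (by positivity)
      obtain ⟨a, ha, hs⟩ := (mem_nhdsLT_iff_exists_Ioo_subset (a := (1 : ℝ))).1 h1
      obtain ⟨M, hM⟩ := exists_nat_one_div_lt (sub_pos.2 (Set.mem_Iio.1 ha))
      refine ⟨M, fun q hq => ?_⟩
      rw [← dist_eq_norm]
      refine le_of_lt (hs ⟨?_, hq.2⟩)
      have : 1 / ((M : ℝ) + 2) ≤ 1 / ((M : ℝ) + 1) :=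
        one_div_le_one_div_of_le (by positivity) (by linarith)
      linarith [hq.1]
    · intro h
      rw [Metric.tendsto_nhds]
      intro ε hε
      obtain ⟨m, hm⟩ := exists_nat_one_div_lt hε
      obtain ⟨M, hM⟩ := h m
      have hM2 : 1 / ((M : ℝ) + 2) < 1 := by
        rw [div_lt_one (by positivity)]
        linarith [(Nat.cast_nonneg M : (0 : ℝ) ≤ M)]
      have hpos : 0 < 1 / ((M : ℝ) + 2) := by positivity
      filter_upwards [Ioo_mem_nhdsLT (show 1 - 1 / ((M : ℝ) + 2) < 1 by linarith)] with r hr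
      rw [dist_eq_norm]
      refine lt_of_le_of_lt ?_ hm
      have hcont : ContinuousOn (fun r : ℝ => ‖f.eval (r • torusPoint t) - boundary n E f t‖)
          (Set.Ioo (1 - 1 / ((M : ℝ) + 2)) 1) :=
        (((continuousOn_eval_radial f t).mono
          (Set.Ioo_subset_Ioo_left (by linarith))).sub continuousOn_const).norm
      by_contra! hlt
      have hnhds := (hcont.continuousAt (Ioo_mem_nhds hr.1 hr.2)).eventually (lt_mem_nhds hlt)
      have hnhds' := hnhds.and (Ioo_mem_nhds hr.1 hr.2)
      obtain ⟨U, hU, hUo, hrU⟩ := mem_nhds_iff.1 hnhds'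
      obtain ⟨q, hq⟩ := Rat.denseRange_cast.exists_mem_open hUo ⟨r, hrU⟩
      have h2 := hU hq
      exact absurd (hM q h2.2) (not_le.2 h2.1)
  rw [key]
  refine MeasurableSet.iInter fun m => MeasurableSet.iUnion fun M => MeasurableSet.iInter fun q =>
    MeasurableSet.iInter fun hq => ?_
  have hM2 : 1 / ((M : ℝ) + 2) < 1 := by
    rw [div_lt_one (by positivity)]
    linarith [(Nat.cast_nonneg M : (0 : ℝ) ≤ M)]
  have hq0 : (0 : ℝ) < q := by linarith [hq.1]
  exact measurableSet_le
    (((continuous_eval_smul_torusPoint f hq0 hq.2).stronglyMeasurable.sub hbm).norm.measurable)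
    measurable_const

/-- **Fatou's theorem** for the vector-valued Hardy space of the polydisc. -/
theorem ae_tendsto_eval_boundary (f : HardySpace n E) :
    ∀ᵐ t ∂torusMeasure n, Tendsto (fun r : ℝ => f.eval (r • torusPoint t)) (𝓝[<] 1)
      (𝓝 (boundary n E f t)) := by
  have hP := ae_eval_eq_integral_circlePoisson f
  -- The Poisson representation is used at the rotated points, where its integrand is the boundary
  -- function on the circle through `t`, translated by `s`. Fatou's theorem on that circle then
  -- gives the limit for almost every `s`.
  have hP' := Measure.ae_ae_of_ae_prod (measurePreserving_rotate.quasiMeasurePreserving.ae hP)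
  have hm := measurableSet_tendsto_eval f
  have hmap := ae_map_iff (μ := (torusMeasure n).prod volume) continuous_rotate.aemeasurable hm
  rw [measurePreserving_rotate.map_eq] at hmap
  refine hmap.2 ((Measure.ae_prod_iff_ae_ae (continuous_rotate.measurable hm)).2 ?_)
  filter_upwards [hP, hP'] with t ht ht'
  filter_upwards [ht', ae_tendsto_integral_circlePoisson ht.1] with s hs hs'
  refine hs'.congr' ?_
  filter_upwards [Ioo_mem_nhdsLT (zero_lt_one' ℝ)] with r hr
  rw [hs.2 r hr.1 hr.2]
  simp only [rotate_rotate]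

end

section

open ContinuousLinearMap

/-! ### The Toeplitz property -/

section

variable {n : ℕ} {E : Type*} [NormedAddCommGroup E] [InnerProductSpace ℂ E] [CompleteSpace E]

theorem isDoublyCommuting_shift :
    IsDoublyCommuting (shift : (Fin n → ℕ) → HardySpace n E →ₗᵢ[ℂ] HardySpace n E) where
  map_zero := shift_zero
  map_add := shift_add
  adjoint_comm _ _ x hij := adjoint_shift_comm hij x
  pure _ _ h := eq_zero_of_forall_mem_range_shift _ h

/-- The symbol `ζ ^ k` times the identity. -/
def monomialSymbol (k : Fin n → ℕ) : LInfty n E where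
  toFun t := torusMonomial k t • ContinuousLinearMap.id ℂ E
  aestronglyMeasurable_apply η := (memLp_monomial_smul k η).1
  essBounded := ⟨1, .of_forall fun t => by
    rw [norm_smul, norm_torusMonomial_apply, one_mul]
    exact norm_id_le⟩

theorem torusMonomial_add (k l : Fin n → ℕ) (t : UnitAddTorus (Fin n)) :
    torusMonomial (k + l) t = torusMonomial k t * torusMonomial l t := by
  simp [torusMonomial_apply, pow_add, Finset.prod_mul_distrib]

/-- Both sides depend continuously on `f`, the right one as a Laurent operator, and they agree on
monomials. -/
theorem boundary_shift_ae (l : Fin n → ℕ) (f : HardySpace n E) :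
    boundary n E (shift l f) =ᵐ[torusMeasure n] fun t => torusMonomial l t • boundary n E f t := by
  have h : (boundary n E).toContinuousLinearMap ∘L (shift l).toContinuousLinearMap =
      (monomialSymbol l).laurent ∘L (boundary n E).toContinuousLinearMap := by
    refine hardySpace_ext fun k η => ?_
    refine Lp.ext ?_
    change boundary n E (shift l (monomial k η)) =ᵐ[torusMeasure n]
      (monomialSymbol l).laurent (boundary n E (monomial k η))
    rw [shift_monomial]
    filter_upwards [boundary_monomial_ae (k + l) η, boundary_monomial_ae k η,
      (monomialSymbol l).laurent_coeFn (boundary n E (monomial k η))] with t h1 h2 h3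
    rw [h1, h3, h2, torusMonomial_add, mul_comm, mul_smul]
    rfl
  have h' : boundary n E (shift l f) = (monomialSymbol l).laurent (boundary n E f) :=
    DFunLike.congr_fun h f
  rw [h']
  exact (monomialSymbol l).laurent_coeFn _

theorem inner_toeplitz (Φ : LInfty n E) (f g : HardySpace n E) :
    inner ℂ (Φ.toeplitz f) g = inner ℂ (Φ.laurent (boundary n E f)) (boundary n E g) :=
  adjoint_inner_left (boundary n E).toContinuousLinearMap g _

omit [CompleteSpace E] in
theorem inner_torusMonomial_smul_smul (k : Fin n → ℕ) (t : UnitAddTorus (Fin n)) (x y : E) :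
    inner ℂ (torusMonomial k t • x) (torusMonomial k t • y) = inner ℂ x y := by
  rw [inner_smul_left, inner_smul_right, ← mul_assoc, RCLike.conj_mul,
    norm_torusMonomial_apply]
  simp

/-- The scalar `ζ ^ l` commutes with `Φ(ζ)` and is unimodular, so it cancels in the pointwise inner
product. -/
theorem adjoint_shift_toeplitz_shift (Φ : LInfty n E) (l : Fin n → ℕ) (f : HardySpace n E) :
    adjoint (shift l).toContinuousLinearMap (Φ.toeplitz (shift l f)) = Φ.toeplitz f := by
  refine ext_inner_right ℂ fun g => ?_
  rw [adjoint_inner_left, LinearIsometry.coe_toContinuousLinearMap, inner_toeplitz,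
    inner_toeplitz, L2.inner_def, L2.inner_def]
  refine integral_congr_ae ?_
  filter_upwards [Φ.laurent_coeFn (boundary n E (shift l f)), Φ.laurent_coeFn (boundary n E f),
    boundary_shift_ae l f, boundary_shift_ae l g] with t h1 h2 h3 h4
  rw [h1, h2, h3, h4, map_smul, inner_torusMonomial_smul_smul]

/-- Radial limits recover the boundary function, and the boundary map is injective. -/
theorem hardySpace_eq_of_eval_eq {f g : HardySpace n E} (h : ∀ z ∈ polydisc n, f.eval z = g.eval z) :
    f = g := by
  refine (boundary n E).injective (Lp.ext ?_)
  filter_upwards [ae_tendsto_eval_boundary f, ae_tendsto_eval_boundary g] with t hf hg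
  refine tendsto_nhds_unique (hf.congr' ?_) hg
  filter_upwards [Ioo_mem_nhdsLT (zero_lt_one' ℝ)] with r hr
  exact h _ (smul_torusPoint_mem t hr.1 hr.2)

omit [CompleteSpace E] in
theorem eval_monomial_zero (η : E) (z : Fin n → ℂ) :
    (monomial 0 η : HardySpace n E).eval z = η := by
  simp [eval_monomial]

theorem norm_boundary_sq (f : HardySpace n E) :
    ∫ t, ‖boundary n E f t‖ ^ 2 ∂torusMeasure n = ‖f‖ ^ 2 := by
  have h := L2.inner_def (𝕜 := ℂ) (boundary n E f) (boundary n E f)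
  simp only [inner_self_eq_norm_sq_to_K, LinearIsometry.norm_map] at h
  have h2 : ∫ t, ((‖boundary n E f t‖ ^ 2 : ℝ) : ℂ) ∂torusMeasure n = ((‖f‖ ^ 2 : ℝ) : ℂ) := by
    push_cast
    exact h.symm
  rw [integral_complex_ofReal] at h2
  exact_mod_cast h2

/-- The bound passes to radial limits, so `‖f‖ ^ 2 - ‖f(ζ)‖ ^ 2` is nonnegative almost everywhere;
its integral over a probability space is zero. -/
theorem ae_norm_boundary_eq {f : HardySpace n E}
    (h : ∀ z ∈ polydisc n, ‖f.eval z‖ ≤ ‖f‖) :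
    ∀ᵐ t ∂torusMeasure n, ‖boundary n E f t‖ = ‖f‖ := by
  have hle : ∀ᵐ t ∂torusMeasure n, ‖boundary n E f t‖ ≤ ‖f‖ := by
    filter_upwards [ae_tendsto_eval_boundary f] with t ht
    refine le_of_tendsto ht.norm ?_
    filter_upwards [Ioo_mem_nhdsLT (zero_lt_one' ℝ)] with r hr
    exact h _ (smul_torusPoint_mem t hr.1 hr.2)
  have hint : Integrable (fun t => ‖boundary n E f t‖ ^ 2) (torusMeasure n) :=
    (Lp.memLp (boundary n E f)).integrable_norm_pow two_ne_zero
  have h0 : ∫ t, (‖f‖ ^ 2 - ‖boundary n E f t‖ ^ 2) ∂torusMeasure n = 0 := by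
    rw [integral_sub (integrable_const _) hint, norm_boundary_sq]
    simp
  rw [integral_eq_zero_iff_of_nonneg_ae] at h0
  · filter_upwards [h0] with t ht
    have ht : ‖f‖ ^ 2 - ‖boundary n E f t‖ ^ 2 = 0 := ht
    exact (pow_left_inj₀ (norm_nonneg _) (norm_nonneg _) two_ne_zero).1 (by linarith)
  · filter_upwards [hle] with t ht
    exact sub_nonneg.2 (pow_le_pow_left₀ (norm_nonneg _) ht 2)
  · exact (integrable_const _).sub hint

end

/-! ### Inner functions and isometric multiplication operators -/

section

variable {n : ℕ} {E F : Type*} [NormedAddCommGroup E] [InnerProductSpace ℂ E] [CompleteSpace E]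
  [NormedAddCommGroup F] [InnerProductSpace ℂ F] [CompleteSpace F]

/-- The symbol of an operator that intertwines the shifts. -/
def symbol (V : HardySpace n F →L[ℂ] HardySpace n E) (z : Fin n → ℂ) : F →L[ℂ] E :=
  ∑' k : Fin n → ℕ, (∏ i, z i ^ k i) •
    (lp.evalCLM ℂ (fun _ : Fin n → ℕ => E) 2 k ∘L V ∘L (monomial 0).toContinuousLinearMap)

omit [CompleteSpace E] [CompleteSpace F] in
theorem norm_symbol_coeff_le (V : HardySpace n F →ₗᵢ[ℂ] HardySpace n E) (k : Fin n → ℕ) :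
    ‖lp.evalCLM ℂ (fun _ : Fin n → ℕ => E) 2 k ∘L V.toContinuousLinearMap ∘L
      (monomial 0).toContinuousLinearMap‖ ≤ 1 := by
  refine opNorm_le_bound _ zero_le_one fun η => ?_
  rw [one_mul, ← (monomial 0 : F →ₗᵢ[ℂ] HardySpace n F).norm_map η,
    ← V.norm_map (monomial 0 η)]
  exact lp.norm_apply_le_norm (by norm_num) (V (monomial 0 η)) k

omit [CompleteSpace F] in
theorem symbol_apply (V : HardySpace n F →ₗᵢ[ℂ] HardySpace n E) {z : Fin n → ℂ}
    (hz : z ∈ polydisc n) (η : F) :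
    symbol V.toContinuousLinearMap z η = (V (monomial 0 η)).eval z := by
  have hs : Summable fun k : Fin n → ℕ => (∏ i, z i ^ k i) •
      (lp.evalCLM ℂ (fun _ : Fin n → ℕ => E) 2 k ∘L V.toContinuousLinearMap ∘L
        (monomial 0).toContinuousLinearMap) := by
    refine Summable.of_norm_bounded (summable_monomial hz) fun k => ?_
    rw [norm_smul]
    exact mul_le_of_le_one_right (norm_nonneg _) (norm_symbol_coeff_le V k)
  have h1 := hs.hasSum.mapL (ContinuousLinearMap.apply ℂ E η)
  refine h1.unique ?_
  exact HardySpace.hasSum_eval (V (monomial 0 η)) hz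

theorem isMultiplicationOperator_symbol {V : HardySpace n F →ₗᵢ[ℂ] HardySpace n E}
    (hV : ∀ k η, V (monomial k η) = shift k (V (monomial 0 η))) :
    IsMultiplicationOperator (symbol V.toContinuousLinearMap) V.toContinuousLinearMap := by
  intro f z hz
  have h : evalCLM hz ∘L V.toContinuousLinearMap =
      symbol V.toContinuousLinearMap z ∘L evalCLM hz := by
    refine hardySpace_ext fun k η => ?_
    simp only [coe_comp, Function.comp, LinearIsometry.coe_toContinuousLinearMap, evalCLM_apply]
    rw [hV, eval_shift hz, eval_monomial, map_smul, symbol_apply V hz]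
  exact DFunLike.congr_fun h f

theorem isInner_symbol {V : HardySpace n F →ₗᵢ[ℂ] HardySpace n E}
    (hV : ∀ k η, V (monomial k η) = shift k (V (monomial 0 η))) :
    IsInner (symbol V.toContinuousLinearMap) := by
  have hle : ∀ z ∈ polydisc n, ∀ η, ‖symbol V.toContinuousLinearMap z η‖ ≤ ‖η‖ := fun z hz =>
    norm_symbol_le (isMultiplicationOperator_symbol hV) (fun f => (V.norm_map f).le) hz
  refine ⟨⟨differentiableOn_tsum_monomial (norm_symbol_coeff_le V), 1, fun z hz => ?_⟩,
    fun η => ?_⟩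
  · exact opNorm_le_bound _ zero_le_one fun η => by simpa using hle z hz η
  · have hn : ‖V (monomial 0 η)‖ = ‖η‖ := by
      rw [V.norm_map, LinearIsometry.norm_map]
    have hb := ae_norm_boundary_eq (f := V (monomial 0 η)) fun z hz => by
      rw [← symbol_apply V hz, hn]
      exact hle z hz η
    filter_upwards [hb, ae_tendsto_eval_boundary (V (monomial 0 η))] with t h1 h2
    refine ⟨_, h2.congr' ?_, h1.trans hn⟩
    filter_upwards [Ioo_mem_nhdsLT (zero_lt_one' ℝ)] with r hr
    exact (symbol_apply V (smul_torusPoint_mem t hr.1 hr.2) η).symm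

variable {Ψ : (Fin n → ℂ) → F →L[ℂ] E} {M : HardySpace n F →L[ℂ] HardySpace n E}

omit [CompleteSpace F] in
theorem IsMultiplicationOperator.map_monomial (hM : IsMultiplicationOperator Ψ M)
    (k : Fin n → ℕ) (η : F) : M (monomial k η) = shift k (M (monomial 0 η)) := by
  refine hardySpace_eq_of_eval_eq fun z hz => ?_
  rw [hM _ z hz, eval_shift hz, hM _ z hz, eval_monomial, eval_monomial_zero, map_smul]

omit [CompleteSpace F] in
theorem IsMultiplicationOperator.ae_norm_boundary_eq (hM : IsMultiplicationOperator Ψ M)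
    (hΨ : HasIsometricBoundaryValues Ψ) (η : F) :
    ∀ᵐ t ∂torusMeasure n, ‖boundary n E (M (monomial 0 η)) t‖ = ‖η‖ := by
  filter_upwards [hΨ η, ae_tendsto_eval_boundary (M (monomial 0 η))] with t ⟨y, hy, hn⟩ ht
  rw [← hn]
  congr 1
  refine tendsto_nhds_unique (ht.congr' ?_) hy
  filter_upwards [Ioo_mem_nhdsLT (zero_lt_one' ℝ)] with r hr
  rw [hM _ _ (smul_torusPoint_mem t hr.1 hr.2), eval_monomial_zero]

-- Polarization. It uses the norm identity for only four vectors `η + c ξ`, so no separability of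
-- `F` is required.
omit [CompleteSpace F] in
theorem IsMultiplicationOperator.ae_inner_boundary_eq (hM : IsMultiplicationOperator Ψ M)
    (hΨ : HasIsometricBoundaryValues Ψ) (η ξ : F) :
    ∀ᵐ t ∂torusMeasure n, inner ℂ (boundary n E (M (monomial 0 η)) t)
      (boundary n E (M (monomial 0 ξ)) t) = inner ℂ η ξ := by
  have h : ∀ c : ℂ, ∀ᵐ t ∂torusMeasure n, ‖boundary n E (M (monomial 0 η)) t +
      c • boundary n E (M (monomial 0 ξ)) t‖ = ‖η + c • ξ‖ := by
    intro c
    have h1 := hM.ae_norm_boundary_eq hΨ (η + c • ξ)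
    rw [map_add, map_add, map_add, map_smul, map_smul, map_smul] at h1
    filter_upwards [h1, Lp.coeFn_add (boundary n E (M (monomial 0 η)))
      (c • boundary n E (M (monomial 0 ξ))), Lp.coeFn_smul c (boundary n E (M (monomial 0 ξ)))]
      with t h1 h2 h3
    rw [h2, Pi.add_apply, h3, Pi.smul_apply] at h1
    exact h1
  filter_upwards [h 1, h (-1), h Complex.I, h (-Complex.I)] with t h1 h2 h3 h4
  rw [inner_eq_sum_norm_sq_div_four, inner_eq_sum_norm_sq_div_four]
  simp only [one_smul, neg_smul, ← sub_eq_add_neg] at h1 h2 h3 h4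
  have hI : (RCLike.I : ℂ) = Complex.I := rfl
  rw [hI, h1, h2, h3, h4]

theorem IsMultiplicationOperator.inner_map_map (hM : IsMultiplicationOperator Ψ M)
    (hΨ : HasIsometricBoundaryValues Ψ) (f g : HardySpace n F) :
    inner ℂ (M f) (M g) = inner ℂ f g := by
  have h0 : ∀ k η l ξ, inner ℂ (M (monomial k η)) (M (monomial l ξ)) =
      inner ℂ (monomial k η : HardySpace n F) (monomial l ξ) := by
    intro k η l ξ
    rw [hM.map_monomial k, hM.map_monomial l, ← (boundary n E).inner_map_map,
      ← (boundary n F).inner_map_map, L2.inner_def, L2.inner_def]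
    refine integral_congr_ae ?_
    filter_upwards [boundary_shift_ae k (M (monomial 0 η)), boundary_shift_ae l (M (monomial 0 ξ)),
      boundary_monomial_ae k η, boundary_monomial_ae l ξ, hM.ae_inner_boundary_eq hΨ η ξ]
      with t h1 h2 h3 h4 h5
    rw [h1, h2, h3, h4, inner_smul_left, inner_smul_right, h5, inner_smul_left, inner_smul_right]
  -- Density of the span of monomials is used once in each argument, through `M* M = 1`.
  have h1 : ∀ k η, adjoint M (M (monomial k η)) = monomial k η := by
    intro k η
    have : innerSL ℂ (adjoint M (M (monomial k η))) = innerSL ℂ (monomial k η) := by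
      refine hardySpace_ext fun l ξ => ?_
      rw [innerSL_apply_apply, innerSL_apply_apply, adjoint_inner_left, h0]
    exact ext_inner_right ℂ fun g => DFunLike.congr_fun this g
  have h2 : adjoint M ∘L M = ContinuousLinearMap.id ℂ _ := hardySpace_ext h1
  rw [← adjoint_inner_left]
  exact congrArg (inner ℂ · g) (DFunLike.congr_fun h2 f)

theorem adjoint_constantOperator (U : F →L[ℂ] F) :
    adjoint (constantOperator n U) = constantOperator n (adjoint U) := by
  refine ((eq_adjoint_iff _ _).2 fun f g => ?_).symm
  rw [lp.inner_eq_tsum, lp.inner_eq_tsum]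
  exact tsum_congr fun k => adjoint_inner_left U (g k) (f k)

omit [CompleteSpace F] in
theorem constantOperator_apply_apply {U W : F →L[ℂ] F} (h : ∀ η, U (W η) = η)
    (f : HardySpace n F) : constantOperator n U (constantOperator n W f) = f :=
  lp.ext (funext fun k => h (f k))

/-- Since `M* M = 1` and `U` is unitary, both products collapse to `M M*`. -/
theorem isStarNormal_of_isMultiplicationOperator (hM : IsMultiplicationOperator Ψ M)
    (hΨ : HasIsometricBoundaryValues Ψ) (U : unitary (F →L[ℂ] F)) :
    IsStarNormal (M ∘L constantOperator n (U : F →L[ℂ] F) ∘L adjoint M) := by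
  have hMM : ∀ f, adjoint M (M f) = f := fun f => ext_inner_right ℂ fun g => by
    rw [adjoint_inner_left, hM.inner_map_map hΨ]
  have h1 : ∀ η, adjoint (U : F →L[ℂ] F) ((U : F →L[ℂ] F) η) = η := fun η =>
    DFunLike.congr_fun (Unitary.coe_star_mul_self U) η
  have h2 : ∀ η, (U : F →L[ℂ] F) (adjoint (U : F →L[ℂ] F) η) = η := fun η =>
    DFunLike.congr_fun (Unitary.coe_mul_star_self U) η
  refine ⟨?_⟩
  refine ContinuousLinearMap.ext fun x => ?_
  rw [star_eq_adjoint, adjoint_comp, adjoint_comp, adjoint_adjoint, adjoint_constantOperator]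
  change M (constantOperator n (adjoint (U : F →L[ℂ] F)) (adjoint M
      (M (constantOperator n (U : F →L[ℂ] F) (adjoint M x))))) =
    M (constantOperator n (U : F →L[ℂ] F) (adjoint M
      (M (constantOperator n (adjoint (U : F →L[ℂ] F)) (adjoint M x)))))
  rw [hMM, hMM, constantOperator_apply_apply h1, constantOperator_apply_apply h2]

end

end

end

end PolydiscToeplitz

open PolydiscToeplitz ContinuousLinearMap in
/-- A partially isometric Toeplitz operator `T_Φ` on `H²_E(𝔻ⁿ)` is normal if and only if
`T_Φ = M_Ψ U M_Ψ*` for a Hilbert space `F`, an inner function `Ψ ∈ H^∞_{B(F,E)}(𝔻ⁿ)` and a constant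
unitary `U ∈ B(F)`. -/
theorem corollary4p6 {n : ℕ} {E : Type u} [NormedAddCommGroup E] [InnerProductSpace ℂ E]
    [CompleteSpace E] (Φ : LInfty n E) (hΦ : IsPartialIsometry Φ.toeplitz) :
    IsStarNormal Φ.toeplitz ↔
      ∃ (F : Type u) (_ : NormedAddCommGroup F) (_ : InnerProductSpace ℂ F) (_ : CompleteSpace F)
        (Ψ : (Fin n → ℂ) → F →L[ℂ] E) (U : unitary (F →L[ℂ] F))
        (M : HardySpace n F →L[ℂ] HardySpace n E),
        IsInner Ψ ∧ IsMultiplicationOperator Ψ M ∧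
          Φ.toeplitz = M ∘L constantOperator n (U : F →L[ℂ] F) ∘L adjoint M := by
  constructor
  · intro hn
    obtain ⟨F, _, _, _, V, U, hV, hT⟩ := hΦ.exists_model isDoublyCommuting_shift hn
      fun i x => adjoint_shift_toeplitz_shift Φ _ x
    exact ⟨F, _, _, inferInstance, symbol V.toContinuousLinearMap, U, V.toContinuousLinearMap,
      isInner_symbol hV, isMultiplicationOperator_symbol hV, hT⟩
  · rintro ⟨F, _, _, _, Ψ, U, M, hΨ, hM, hT⟩
    rw [hT]
    exact isStarNormal_of_isMultiplicationOperator hM hΨ.2 U
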